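/- Let $\mathbb{Q}(r)$ be the field of rational functions in one indeterminate $r$ over $\mathbb{Q}$, and let $E_r$ be the elliptic curve over $\mathbb{Q}(r)$ given by $$E_r:\quad y^2=(x+2r^2)(x-2r^2)(x-r^4-1).$$ Then the group $E_r(\mathbb{Q}(r))$ has rank $0$. Its torsion subgroup is isomorphic to $\mathbb{Z}/2\mathbb{Z}\times\mathbb{Z}/4\mathbb{Z}$ and is given by $$E_r(\mathbb{Q}(r))_{\mathrm{tors}}=\{\mathcal{O},\ (-2r^2,0),\ (2r^2,0),\ (r^4+1,0),\ (2r^4,\pm 2r^2(r^4-1)),\ (2,\pm 2(r^4-1))\}.$$ -/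

import Mathlib

/-- The curve `y² = (x + 2r²)(x - 2r²)(x - r⁴ - 1)` over a commutative ring `R` containing `r`,
as a Weierstrass curve: the right-hand side is expanded into
`x³ - (r⁴ + 1)x² - 4r⁴x + 4r⁴(r⁴ + 1)`. -/
def curveE {R : Type*} [CommRing R] (r : R) : WeierstrassCurve R where
  a₁ := 0
  a₂ := -(r ^ 4 + 1)
  a₃ := 0
  a₄ := -4 * r ^ 4
  a₆ := 4 * r ^ 4 * (r ^ 4 + 1)

/-- The affine equation of `curveE r` is the factored one. -/
theorem curveE_equation_iff {R : Type*} [CommRing R] (r x y : R) :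
    (curveE r).toAffine.Equation x y ↔
      y ^ 2 = (x + 2 * r ^ 2) * (x - 2 * r ^ 2) * (x - r ^ 4 - 1) := by
  rw [WeierstrassCurve.Affine.equation_iff]
  simp only [curveE]
  constructor <;> intro h <;> linear_combination h

/-- The generic curve: `curveE r` over the rational function field `ℚ(r)`, with `r` the
indeterminate. -/
noncomputable def genericE : WeierstrassCurve (RatFunc ℚ) := curveE RatFunc.X

/-!
Put `X = x - (r⁴ + 1)`, `a = r² - 1` and `b = r² + 1`. The curve becomes `y² = X (X + a²) (X + b²)`
with `b² - a² = (2r)²`. The proof has two halves.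

*Descent by 2.* Modulo squares, the factors of `X (X + a²) (X + b²)` at a point involve only
constants and the primes `r - 1`, `r + 1`, `r² + 1`, `r` (`exists_square_classes`). Adding the
4-torsion point with `X = ab` removes the prime `r² + 1`. The conditions at `r = 1, -1, 0, ∞` and `i`
then force `X` to be a square up to sign and `X + b²` to be a square
(`isSquare_or_neg_and_isSquare`); the condition at `i` uses that neither `2` nor `-2` is a square in
`ℚ(i)`. The sign is removed by adding the point `X = -a²`. Since a point at which all three factors
are squares is a double (`exists_add_self_eq`), every point is `t + 2Q` with `t` in the group `T`
generated by these two torsion points (`exists_eq_torsion_add_add_self`).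

*Growth of denominators.* The singular fibres at finite places are of type `I₄`, so every point of
`4E` passes through their identity components (`meetsIdentityComponents_of_double`). For such a point
there is no cancellation in the duplication formula, and the degree of the denominator of `x`
strictly increases under doubling (`isCoprime_double`,
`IsSquarePresentation.natDegree_lt_of_double`). As `4T = 0`, the first half gives `4E = 8E`, so a
nonzero point of `4E` is twice a point of `4E` with a denominator of smaller degree. By infinite
descent `4E = 0` (`four_nsmul_eq_zero`).

Consequently `E = T + 2E = T + 2(T + 2E) = T`, and `T` is the image of an injective homomorphism from
`ℤ/2 × ℤ/4` whose eight values are computed.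
-/

open WeierstrassCurve Polynomial

/-! ### The group law and squares -/

section GroupLaw

variable {F : Type*} [Field F] [DecidableEq F] {r : F}

theorem curveE_Δ {R : Type*} [CommRing R] (r : R) :
    (curveE r).Δ = 16 * (2 * r * (r ^ 2 - 1) * (r ^ 2 + 1)) ^ 4 := by
  simp only [WeierstrassCurve.Δ, b₂, b₄, b₆, b₈, curveE]
  ring

omit [DecidableEq F] in
theorem curveE_negY (x y : F) : (curveE r).toAffine.negY x y = -y := by
  simp [Affine.negY, curveE]

/-- If `P + Q = R`, the product of the values of `x - e` at the three points is a square, for each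
root `e` of the cubic: evaluate at `e` the factorization of the cubic minus the square of the line
through `P` and `Q`. This is the multiplicativity of the 2-descent map `P ↦ x(P) - e` modulo
squares. -/
theorem isSquare_of_add_eq {x₁ y₁ x₂ y₂ x₃ y₃ e : F}
    (h₁ : (curveE r).toAffine.Nonsingular x₁ y₁) (h₂ : (curveE r).toAffine.Nonsingular x₂ y₂)
    (h₃ : (curveE r).toAffine.Nonsingular x₃ y₃)
    (h : Affine.Point.some x₁ y₁ h₁ + .some x₂ y₂ h₂ = .some x₃ y₃ h₃)
    (he : (curveE r).toAffine.Equation e 0) :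
    IsSquare ((x₁ - e) * (x₂ - e) * (x₃ - e)) := by
  have hxy : ¬(x₁ = x₂ ∧ y₁ = (curveE r).toAffine.negY x₂ y₂) := by
    rintro ⟨hx, hy⟩
    rw [Affine.Point.add_of_Y_eq hx hy] at h
    exact Affine.Point.some_ne_zero h₃ h.symm
  rw [Affine.Point.add_some hxy, Affine.Point.some.injEq] at h
  have key := congrArg (Polynomial.eval e) (Affine.addPolynomial_slope h₁.1 h₂.1 hxy)
  rw [h.1, Affine.addPolynomial_eq] at key
  simp only [Cubic.toPoly, curveE, eval_neg, eval_add, eval_mul, eval_C, eval_pow, eval_X,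
    eval_sub] at key
  rw [curveE_equation_iff] at he
  set l := (curveE r).toAffine.slope x₁ x₂ y₁ y₂ with hl
  refine ⟨l * (e - x₁) + y₁, ?_⟩
  simp only [curveE] at key hl
  rw [← hl] at key
  linear_combination -key + he

/-- The duplication formula, in the form: `x(2P) - e` is the square of
`((x - e)² - (e - e')(e - e'')) / 2y`, where `e'`, `e''` are the other two roots. Here `e` is
`r⁴ + 1` or `2r²`. -/
theorem double_X {x y x' y' : F}
    (h₁ : (curveE r).toAffine.Nonsingular x y) (h₂ : (curveE r).toAffine.Nonsingular x' y')
    (h : Affine.Point.some x y h₁ + .some x y h₁ = .some x' y' h₂) :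
    2 * y ≠ 0 ∧
    (x' - (r ^ 4 + 1)) * (2 * y) ^ 2 = ((x - (r ^ 4 + 1)) ^ 2 - (r ^ 4 - 1) ^ 2) ^ 2 ∧
    (x' - 2 * r ^ 2) * (2 * y) ^ 2 =
      ((x - 2 * r ^ 2) ^ 2 + 4 * r ^ 2 * (r ^ 2 - 1) ^ 2) ^ 2 := by
  have hy : y ≠ (curveE r).toAffine.negY x y := by
    intro hy
    rw [Affine.Point.add_self_of_Y_eq hy] at h
    exact Affine.Point.some_ne_zero h₂ h.symm
  rw [Affine.Point.add_self_of_Y_ne hy, Affine.Point.some.injEq] at h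
  have h2 : 2 * y ≠ 0 := by
    intro h0
    apply hy
    rw [curveE_negY]
    linear_combination h0
  refine ⟨h2, ?_⟩
  have hE := (curveE_equation_iff _ _ _).1 h₁.1
  have hs := Affine.slope_of_Y_ne (W := (curveE r).toAffine) rfl hy
  rw [curveE_negY, show y - -y = 2 * y by ring, eq_div_iff h2] at hs
  obtain ⟨hx, -⟩ := h
  simp only [Affine.addX] at hx
  set l := (curveE r).toAffine.slope x x y y
  simp only [curveE] at hx hs
  constructor
  · rw [← hx]
    have : (l * (2 * y)) ^ 2 = (3 * x ^ 2 + 2 * -(r ^ 4 + 1) * x + -4 * r ^ 4 - 0 * y) ^ 2 := by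
      rw [hs]
    linear_combination this - 4 * (2 * x) * hE
  · rw [← hx]
    have : (l * (2 * y)) ^ 2 = (3 * x ^ 2 + 2 * -(r ^ 4 + 1) * x + -4 * r ^ 4 - 0 * y) ^ 2 := by
      rw [hs]
    linear_combination this + 4 * (r ^ 4 + 1 - 2 * x - 2 * r ^ 2) * hE

/-- A point at which the three linear factors are squares `p²`, `q²`, `s²` is twice a point, namely
the one with `x - (r⁴ + 1) = (p + q)(p + s)` and `y = (p + q)(p + s)(q + s)` for a suitable sign of
`p`. -/
theorem exists_add_self_eq [(curveE r).IsElliptic] {x y p q s : F}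
    (h : (curveE r).toAffine.Nonsingular x y)
    (hp : x - (r ^ 4 + 1) = p ^ 2) (hq : x - 2 * r ^ 2 = q ^ 2) (hs : x + 2 * r ^ 2 = s ^ 2) :
    ∃ Q : (curveE r).toAffine.Point, Q + Q = .some x y h := by
  -- The signs of the square roots are free; the sign of `p` is chosen to match `y`.
  wlog hy : y = p * q * s generalizing p
  · refine this (p := -p) (by rw [hp]; ring) ?_
    have hE := (curveE_equation_iff _ _ _).1 h.1
    have : (y - p * q * s) * (y + p * q * s) = 0 := by
      rw [show x - r ^ 4 - 1 = p ^ 2 by rw [← hp]; ring, hq, hs] at hE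
      linear_combination hE
    rcases mul_eq_zero.1 this with h0 | h0
    · exact absurd (by linear_combination h0) hy
    · linear_combination h0
  have hΔ := (curveE r).isUnit_Δ.ne_zero
  rw [curveE_Δ] at hΔ
  have hpq : (p + q) * (p - q) = -(r ^ 2 - 1) ^ 2 := by linear_combination hq - hp
  have hps : (p + s) * (p - s) = -(r ^ 2 + 1) ^ 2 := by linear_combination hs - hp
  have hqs : (q + s) * (q - s) = -4 * r ^ 2 := by linear_combination hs - hq
  have hr : (2 : F) * r * (r ^ 2 - 1) * (r ^ 2 + 1) ≠ 0 := fun h0 ↦ hΔ (by rw [h0]; ring)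
  have h2 : (2 : F) ≠ 0 := by intro h0; simp [h0] at hr
  have hpq0 : p + q ≠ 0 := by
    intro h0; apply hr
    rw [h0, zero_mul] at hpq
    rw [pow_eq_zero_iff two_ne_zero |>.1 (neg_eq_zero.1 hpq.symm)]; ring
  have hps0 : p + s ≠ 0 := by
    intro h0; apply hr
    rw [h0, zero_mul] at hps
    rw [pow_eq_zero_iff two_ne_zero |>.1 (neg_eq_zero.1 hps.symm)]; ring
  have hqs0 : q + s ≠ 0 := by
    intro h0; apply hr
    rw [h0, zero_mul] at hqs
    have : (2 * r) ^ 2 = 0 := by linear_combination hqs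
    rw [pow_eq_zero_iff two_ne_zero |>.1 this]; ring
  have e₁ : r ^ 4 + 1 + (p + q) * (p + s) + 2 * r ^ 2 = (p + s) * (q + s) := by
    linear_combination hs - hp
  have e₂ : r ^ 4 + 1 + (p + q) * (p + s) - 2 * r ^ 2 = (p + q) * (q + s) := by
    linear_combination hq - hp
  have hE : (curveE r).toAffine.Equation (r ^ 4 + 1 + (p + q) * (p + s))
      ((p + q) * (p + s) * (q + s)) := by
    rw [curveE_equation_iff, e₁, e₂]; ring
  have hN := Affine.equation_iff_nonsingular.1 hE
  have hY : (p + q) * (p + s) * (q + s) ≠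
      (curveE r).toAffine.negY (r ^ 4 + 1 + (p + q) * (p + s)) ((p + q) * (p + s) * (q + s)) := by
    rw [curveE_negY]
    intro h0
    have : 2 * ((p + q) * (p + s) * (q + s)) = 0 := by linear_combination h0
    simp [h2, hpq0, hps0, hqs0] at this
  refine ⟨.some _ _ hN, ?_⟩
  -- The tangent at the half point has slope `p + q + s`.
  have hsl : (curveE r).toAffine.slope (r ^ 4 + 1 + (p + q) * (p + s))
      (r ^ 4 + 1 + (p + q) * (p + s)) ((p + q) * (p + s) * (q + s))
      ((p + q) * (p + s) * (q + s)) = p + q + s := by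
    rw [Affine.slope_of_Y_ne rfl hY, curveE_negY, div_eq_iff]
    · simp only [curveE]
      linear_combination (p + q) * (p + s) * (e₁ + e₂) +
        (r ^ 4 + 1 + (p + q) * (p + s) + 2 * r ^ 2) * e₂ + (p + q) * (q + s) * e₁
    · intro h0
      have : 2 * ((p + q) * (p + s) * (q + s)) = 0 := by linear_combination h0
      simp [h2, hpq0, hps0, hqs0] at this
  rw [Affine.Point.add_self_of_Y_ne hY, Affine.Point.some.injEq, hsl]
  have hx : (curveE r).toAffine.addX (r ^ 4 + 1 + (p + q) * (p + s))
      (r ^ 4 + 1 + (p + q) * (p + s)) (p + q + s) = x := by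
    simp only [Affine.addX, curveE]
    linear_combination hp - hq - hs
  refine ⟨hx, ?_⟩
  rw [Affine.addY, Affine.negAddY, hx, curveE_negY, hy]
  linear_combination -(p + q + s) * hp

end GroupLaw

/-! ### Square classes in principal ideal domains -/

section SquareClasses

variable {R : Type*} [CommRing R] [IsDomain R] [IsPrincipalIdealRing R]

theorem Prime.even_of_pow_mul_mul_sq_eq_sq {p h u y : R} {n : ℕ} (hp : Prime p) (hh : ¬p ∣ h)
    (hu : u ≠ 0) (H : p ^ n * h * u ^ 2 = y ^ 2) : Even n := by
  have hh0 : h ≠ 0 := fun h0 ↦ hh (h0 ▸ dvd_zero p)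
  have hy : y ≠ 0 := by
    rintro rfl
    have : p ^ n * h * u ^ 2 ≠ 0 := mul_ne_zero (mul_ne_zero (pow_ne_zero _ hp.ne_zero) hh0)
      (pow_ne_zero _ hu)
    exact this (by rw [H]; ring)
  have fin : ∀ z : R, z ≠ 0 → FiniteMultiplicity p z := fun z hz ↦
    FiniteMultiplicity.of_not_isUnit hp.not_isUnit hz
  have key := congrArg (multiplicity p) H
  rw [multiplicity_mul hp, multiplicity_mul hp, (fin y hy).multiplicity_pow hp,
    (fin u hu).multiplicity_pow hp, multiplicity_pow_self hp.ne_zero hp.not_isUnit,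
    multiplicity_eq_zero.2 hh] at key
  · exact ⟨multiplicity p y - multiplicity p u, by omega⟩
  · exact fin _ (mul_ne_zero (pow_ne_zero _ hp.ne_zero) hh0)
  · exact fin _ (H ▸ pow_ne_zero 2 hy)

/-- If `f * g` is a square and every common prime divisor of `f` and `g` divides an element of `l`,
then modulo squares `f` is a unit times a product of distinct entries of `l`. -/
theorem exists_eq_unit_mul_sublist_prod_mul_sq (l : List R) (hl : ∀ q ∈ l, Prime q) {f g y : R}
    (hf : f ≠ 0) (H : f * g = y ^ 2) (hfg : ∀ p, Prime p → p ∣ f → p ∣ g → ∃ q ∈ l, p ∣ q) :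
    ∃ (c : Rˣ) (s : List R) (u : R), s.Sublist l ∧ u ≠ 0 ∧ f = c * s.prod * u ^ 2 := by
  induction l generalizing f g y with
  | nil =>
    have hco : IsCoprime f g := by
      refine isCoprime_of_prime_dvd (fun h ↦ hf h.1) fun p hp h1 h2 ↦ ?_
      simpa using hfg p hp h1 h2
    obtain ⟨u, c, hc⟩ := exists_associated_pow_of_mul_eq_pow' hco H
    refine ⟨c, [], u, List.Sublist.refl _, ?_, ?_⟩
    · rintro rfl; simp at hc; exact hf hc.symm
    · rw [← hc]; simp [mul_comm]
  | cons q l ih =>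
    have hq : Prime q := hl q (by simp)
    obtain ⟨n, f', hf', rfl⟩ : ∃ n f', ¬q ∣ f' ∧ f = q ^ n * f' := by
      obtain ⟨f', h1, h2⟩ :=
        (FiniteMultiplicity.of_not_isUnit hq.not_isUnit hf).exists_eq_pow_mul_and_not_dvd
      exact ⟨_, f', h2, h1⟩
    obtain ⟨k, e, he, rfl⟩ : ∃ k e, e < 2 ∧ n = 2 * k + e :=
      ⟨n / 2, n % 2, Nat.mod_lt _ two_pos, (Nat.div_add_mod n 2).symm⟩
    have hf'0 : f' ≠ 0 := right_ne_zero_of_mul hf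
    obtain ⟨y', rfl⟩ : q ^ k ∣ y := by
      rw [← IsIntegrallyClosed.pow_dvd_pow_iff (n := 2) two_ne_zero, ← H]
      exact ⟨q ^ e * f' * g, by ring⟩
    have hk : q ^ k ≠ 0 := pow_ne_zero _ hq.ne_zero
    have H' : f' * (q ^ e * g) = y' ^ 2 :=
      mul_left_cancel₀ (pow_ne_zero 2 hk) (by linear_combination H)
    obtain ⟨c, s, u, hs, hu, hc⟩ := ih (fun p hp ↦ hl p (by simp [hp])) hf'0 H' (by
      intro p hp h1 h2
      have hpq : ¬p ∣ q := fun h ↦ hf' ((hp.associated_of_dvd hq h).symm.dvd.trans h1)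
      have hpg : p ∣ g := (hp.dvd_or_dvd h2).resolve_left fun h ↦ hpq (hp.dvd_of_dvd_pow h)
      obtain ⟨q', hq', hd⟩ := hfg p hp (h1.mul_left _) hpg
      rcases List.mem_cons.1 hq' with rfl | hm
      · exact absurd hd hpq
      · exact ⟨q', hm, hd⟩)
    interval_cases e
    · exact ⟨c, s, q ^ k * u, hs.cons _, mul_ne_zero hk hu, by rw [hc]; ring⟩
    · exact ⟨c, q :: s, q ^ k * u, hs.cons_cons _, mul_ne_zero hk hu, by
        rw [hc, List.prod_cons]; ring⟩

end SquareClasses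

section Rational

/-- Neither `2` nor `-2` is a square in `ℚ(i)`, stated for the values at `i` of rational
polynomials. -/
theorem aeval_I_eq_zero_of_sq_eq {f g : ℚ[X]} {σ : ℚ} (hσ : σ = 2 ∨ σ = -2)
    (h : aeval Complex.I f ^ 2 = (σ : ℂ) * aeval Complex.I g ^ 2) : aeval Complex.I g = 0 := by
  have ratl : ∀ f : ℚ[X], ∃ u v : ℚ, aeval Complex.I f = u + v * Complex.I := by
    intro f
    induction f using Polynomial.induction_on' with
    | add p q hp hq =>
      obtain ⟨a, b, h1⟩ := hp
      obtain ⟨c, d, h2⟩ := hq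
      exact ⟨a + c, b + d, by rw [map_add, h1, h2]; push_cast; ring⟩
    | monomial n c =>
      induction n with
      | zero => exact ⟨c, 0, by simp⟩
      | succ n ih =>
        obtain ⟨a, b, h1⟩ := ih
        refine ⟨-b, a, ?_⟩
        rw [aeval_monomial] at h1 ⊢
        rw [pow_succ, ← mul_assoc, h1]
        push_cast
        linear_combination b * Complex.I_sq
  by_contra hg
  obtain ⟨a, b, hf'⟩ := ratl f
  obtain ⟨c, d, hg'⟩ := ratl g
  rw [hf', hg'] at h
  rw [hg'] at hg
  have hN : c ^ 2 + d ^ 2 ≠ 0 := by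
    intro h0
    have h1 : c = 0 := by nlinarith [sq_nonneg c, sq_nonneg d]
    have h2 : d = 0 := by nlinarith [sq_nonneg c, sq_nonneg d]
    simp [h1, h2] at hg
  -- The quotient of the two values is again of the form `x + y i` with `x` and `y` rational.
  obtain ⟨x, y, hxy⟩ : ∃ x y : ℚ, ((x : ℂ) + y * Complex.I) ^ 2 = (σ : ℂ) := by
    refine ⟨(a * c + b * d) / (c ^ 2 + d ^ 2), (b * c - a * d) / (c ^ 2 + d ^ 2), ?_⟩
    have hNC : (c : ℂ) ^ 2 + (d : ℂ) ^ 2 ≠ 0 := by exact_mod_cast hN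
    push_cast
    have e1 : ((a : ℂ) * c + b * d) / (c ^ 2 + d ^ 2) + (b * c - a * d) / (c ^ 2 + d ^ 2) *
        Complex.I = (a + b * Complex.I) / (c + d * Complex.I) := by
      field_simp
      linear_combination (b * d * c - a * d ^ 2) * Complex.I_sq
    rw [e1, div_pow, h, mul_div_assoc, div_self (pow_ne_zero 2 hg), mul_one]
  have hns : ∀ z : ℚ, z ^ 2 ≠ 2 := fun z hz ↦ by
    have hz' : (z : ℝ) ^ 2 = 2 := by exact_mod_cast hz
    exact irrational_sqrt_two ⟨|z|, by rw [← hz', Real.sqrt_sq_eq_abs, Rat.cast_abs]⟩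
  have hre : x ^ 2 - y ^ 2 = σ := by
    have := congrArg Complex.re hxy
    simp [pow_two] at this
    rw [pow_two, pow_two]
    exact_mod_cast this
  have him : x * y = 0 := by
    have := congrArg Complex.im hxy
    simp [pow_two] at this
    have h2 : x * y + y * x = 0 := by exact_mod_cast this
    linarith
  rcases mul_eq_zero.1 him with rfl | rfl <;> rcases hσ with rfl | rfl
  · nlinarith [sq_nonneg y]
  · exact hns y (by linarith)
  · exact hns x (by linarith)
  · nlinarith [sq_nonneg x]

end Rational

/-! ### Square classes of the factors of the cubic -/

section LocalConditions

theorem isSquare_of_mul_sq_eq_sq {F : Type*} [Field F] {c w z : F} (hw : w ≠ 0)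
    (h : c * w ^ 2 = z ^ 2) : IsSquare c :=
  ⟨z / w, by field_simp; exact h⟩

theorem IsCoprime.map_ne_zero_of_map_eq_zero {R S : Type*} [CommRing R] [CommRing S] [Nontrivial S]
    (φ : R →+* S) {a d : R} (h : IsCoprime a d) (ha : φ a = 0) : φ d ≠ 0 := by
  intro hd
  have := h.map φ
  rw [ha, hd] at this
  exact not_isCoprime_zero_zero this

theorem exists_pow_mul_of_sublist_cons {R : Type*} [CommRing R] {q : R} {s l : List R}
    (h : s.Sublist (q :: l)) :
    ∃ e ≤ 1, ∃ s' : List R, s'.Sublist l ∧ s.prod = q ^ e * s'.prod := by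
  rcases List.sublist_cons_iff.1 h with h | ⟨t, rfl, ht⟩
  · exact ⟨0, Nat.zero_le _, s, h, by simp⟩
  · exact ⟨1, le_rfl, t, ht, by simp⟩

theorem prime_X_sub_one : Prime (X - 1 : ℚ[X]) := by
  simpa using prime_X_sub_C (1 : ℚ)

theorem prime_X_add_one : Prime (X + 1 : ℚ[X]) := by
  simpa using prime_X_sub_C (-1 : ℚ)

theorem prime_X_sq_add_one : Prime (X ^ 2 + 1 : ℚ[X]) := by
  have hm : (X ^ 2 + 1 : ℚ[X]).natDegree = 2 := by compute_degree!
  refine Irreducible.prime ((irreducible_iff_roots_eq_zero_of_degree_le_three (by omega)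
    (by omega)).2 (Multiset.eq_zero_of_forall_notMem fun t ht ↦ ?_))
  have := (mem_roots'.1 ht).2
  simp only [IsRoot.def, eval_add, eval_pow, eval_X, eval_one] at this
  nlinarith [sq_nonneg t]

theorem isCoprime_X_sq_add_one_X : IsCoprime (X ^ 2 + 1 : ℚ[X]) X :=
  ⟨1, -X, by ring⟩

theorem C_half_mul_two : (C (1 / 2) : ℚ[X]) * 2 = 1 := by
  rw [show (2 : ℚ[X]) = C 2 from rfl, ← C_mul]; norm_num

theorem isCoprime_X_sq_add_one_X_sub_one : IsCoprime (X ^ 2 + 1 : ℚ[X]) (X - 1) :=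
  ⟨C (1 / 2), -C (1 / 2) * (X + 1), by linear_combination C_half_mul_two⟩

theorem isCoprime_X_sq_add_one_X_add_one : IsCoprime (X ^ 2 + 1 : ℚ[X]) (X + 1) :=
  ⟨C (1 / 2), -C (1 / 2) * (X - 1), by linear_combination C_half_mul_two⟩

variable {A D A₂ A₃ Y : ℚ[X]}

/-- The possible square classes of `A = D²(x - r⁴ - 1)` and `A₃ = D²(x + 2r²)`. Common primes of
`A` and the other two factors divide `r⁴ - 1`, those of `A₃` and the others divide `r(r² + 1)`, and
the exponents of `r² + 1` in `A` and `A₃` agree because the product of the three factors is a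
square. -/
theorem exists_square_classes (hAD : IsCoprime A D) (hA₂ : A₂ = A + (X ^ 2 - 1) ^ 2 * D ^ 2)
    (hA₃ : A₃ = A + (X ^ 2 + 1) ^ 2 * D ^ 2) (hY : A * A₂ * A₃ = Y ^ 2) (hY0 : Y ≠ 0) :
    ∃ (c₁ c₃ : ℚ) (e₁ e₂ e₃ e₄ : ℕ) (U W : ℚ[X]), c₁ ≠ 0 ∧ c₃ ≠ 0 ∧ U ≠ 0 ∧ W ≠ 0 ∧
      e₁ ≤ 1 ∧ e₂ ≤ 1 ∧ e₃ ≤ 1 ∧ e₄ ≤ 1 ∧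
      A = C c₁ * (X - 1) ^ e₁ * (X + 1) ^ e₂ * (X ^ 2 + 1) ^ e₃ * U ^ 2 ∧
      A₃ = C c₃ * (X ^ 2 + 1) ^ e₃ * X ^ e₄ * W ^ 2 := by
  have h0 : A * A₂ * A₃ ≠ 0 := hY ▸ pow_ne_zero 2 hY0
  have hA0 : A ≠ 0 := by rintro rfl; simp at h0
  have hA20 : A₂ ≠ 0 := by rintro rfl; simp at h0
  have hA30 : A₃ ≠ 0 := by rintro rfl; simp at h0
  have hpD : ∀ p, Prime p → p ∣ A → ¬p ∣ D := fun p hp h1 h2 ↦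
    hp.not_isUnit (hAD.isUnit_of_dvd' h1 h2)
  have hb := prime_X_sq_add_one
  obtain ⟨c₁, s, U, hs, hU, hA⟩ := exists_eq_unit_mul_sublist_prod_mul_sq
    [(X - 1 : ℚ[X]), X + 1, X ^ 2 + 1]
    (by simp [prime_X_sub_one, prime_X_add_one, hb]) (f := A) (g := A₂ * A₃) hA0
    (by rw [← hY]; ring) (by
      intro p hp h1 h2
      have h3 : p ∣ ((X ^ 2 - 1) * (X ^ 2 + 1) : ℚ[X]) := by
        rcases hp.dvd_or_dvd h2 with h | h
        · rw [hA₂, dvd_add_right h1] at h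
          exact (hp.dvd_of_dvd_pow ((hp.dvd_or_dvd h).resolve_right
            fun h ↦ hpD p hp h1 (hp.dvd_of_dvd_pow h))).mul_right _
        · rw [hA₃, dvd_add_right h1] at h
          exact (hp.dvd_of_dvd_pow ((hp.dvd_or_dvd h).resolve_right
            fun h ↦ hpD p hp h1 (hp.dvd_of_dvd_pow h))).mul_left _
      rw [show (X ^ 2 - 1 : ℚ[X]) = (X - 1) * (X + 1) by ring] at h3
      rcases hp.dvd_or_dvd h3 with h | h
      · rcases hp.dvd_or_dvd h with h | h
        · exact ⟨_, by simp, h⟩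
        · exact ⟨X + 1, by simp, h⟩
      · exact ⟨X ^ 2 + 1, by simp, h⟩)
  obtain ⟨c₃, s', W, hs', hW, hA'⟩ := exists_eq_unit_mul_sublist_prod_mul_sq
    [(X ^ 2 + 1 : ℚ[X]), X] (by simp [hb, prime_X]) (f := A₃) (g := A * A₂) hA30
    (by rw [← hY]; ring) (by
      intro p hp h1 h2
      by_cases hpA : p ∣ A
      · rw [hA₃, dvd_add_right hpA] at h1
        exact ⟨_, by simp, hp.dvd_of_dvd_pow ((hp.dvd_or_dvd h1).resolve_right
            fun h ↦ hpD p hp hpA (hp.dvd_of_dvd_pow h))⟩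
      · have h2 := (hp.dvd_or_dvd h2).resolve_left hpA
        have h3 : p ∣ C 4 * X ^ 2 * D ^ 2 := by
          have := dvd_sub h1 h2
          rw [hA₂, hA₃] at this
          convert this using 1
          rw [show (C 4 : ℚ[X]) = 4 from rfl]; ring
        rcases hp.dvd_or_dvd h3 with h | h
        · rcases hp.dvd_or_dvd h with h | h
          · exact absurd (isUnit_of_dvd_unit h (isUnit_C.2 (by norm_num))) hp.not_isUnit
          · exact ⟨X, by simp, hp.dvd_of_dvd_pow h⟩
        · have hd := hp.dvd_of_dvd_pow h
          refine absurd ?_ hpA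
          rwa [hA₃, dvd_add_left] at h1
          exact (hd.pow two_ne_zero).mul_left _)
  obtain ⟨e₁, h1, s, hs, hp1⟩ := exists_pow_mul_of_sublist_cons hs
  obtain ⟨e₂, h2, s, hs, hp2⟩ := exists_pow_mul_of_sublist_cons hs
  obtain ⟨e₃, h3, s, hs, hp3⟩ := exists_pow_mul_of_sublist_cons hs
  obtain ⟨f₃, g3, s', hs', hp4⟩ := exists_pow_mul_of_sublist_cons hs'
  obtain ⟨e₄, h4, s', hs', hp5⟩ := exists_pow_mul_of_sublist_cons hs'
  rw [List.sublist_nil.1 hs, List.prod_nil, mul_one] at hp3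
  rw [List.sublist_nil.1 hs', List.prod_nil, mul_one] at hp5
  rw [hp1, hp2, hp3] at hA
  rw [hp4, hp5] at hA'
  obtain ⟨c₁', hc₁, hc1⟩ := isUnit_iff.1 c₁.isUnit
  obtain ⟨c₃', hc₃, hc3⟩ := isUnit_iff.1 c₃.isUnit
  rw [← hc1] at hA
  rw [← hc3] at hA'
  obtain rfl : e₃ = f₃ := by
    by_contra hne
    -- Otherwise `X² + 1` divides both `A` and `A₃`, hence not `A₂`, and occurs in `A A₂ A₃` with
    -- odd multiplicity.
    have hbA : (X ^ 2 + 1 : ℚ[X]) ∣ A := by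
      have hbb : (X ^ 2 + 1 : ℚ[X]) ∣ (X ^ 2 + 1) ^ 2 * D ^ 2 :=
        (dvd_pow_self _ two_ne_zero).mul_right _
      have : e₃ = 1 ∨ f₃ = 1 := by omega
      rcases this with rfl | rfl
      · exact ⟨C c₁' * (X - 1) ^ e₁ * (X + 1) ^ e₂ * U ^ 2, by rw [hA]; ring⟩
      · rw [← dvd_add_left hbb, ← hA₃]
        exact ⟨C c₃' * X ^ e₄ * W ^ 2, by rw [hA']; ring⟩
    have hbA2 : ¬(X ^ 2 + 1 : ℚ[X]) ∣ A₂ := by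
      rw [hA₂, dvd_add_right hbA]
      intro h
      rcases hb.dvd_or_dvd h with h | h
      · refine hb.not_isUnit (IsCoprime.isUnit_of_dvd' ?_ dvd_rfl (hb.dvd_of_dvd_pow h))
        rw [show (X ^ 2 - 1 : ℚ[X]) = (X - 1) * (X + 1) by ring]
        exact isCoprime_X_sq_add_one_X_sub_one.mul_right isCoprime_X_sq_add_one_X_add_one
      · exact hpD _ hb hbA (hb.dvd_of_dvd_pow h)
    have := hb.even_of_pow_mul_mul_sq_eq_sq (n := e₃ + f₃)
      (h := C c₁' * (X - 1) ^ e₁ * (X + 1) ^ e₂ * (C c₃' * X ^ e₄) * A₂) (u := U * W) (y := Y)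
      ?_ (mul_ne_zero hU hW) ?_
    · obtain ⟨k, hk⟩ := this
      omega
    · intro h
      refine hb.not_isUnit (IsCoprime.isUnit_of_dvd' ?_ dvd_rfl
        ((hb.dvd_or_dvd h).resolve_right hbA2))
      have hu : ∀ {c : ℚ}, IsUnit c → IsCoprime (X ^ 2 + 1 : ℚ[X]) (C c) := fun h ↦
        (isCoprime_one_right.of_isCoprime_of_dvd_right (isUnit_C.2 h).dvd)
      exact (((hu hc₁).mul_right isCoprime_X_sq_add_one_X_sub_one.pow_right).mul_right
        isCoprime_X_sq_add_one_X_add_one.pow_right).mul_right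
        ((hu hc₃).mul_right isCoprime_X_sq_add_one_X.pow_right)
    · linear_combination hY - A₂ * A₃ * hA - A₂ * (C c₁' * ((X - 1) ^ e₁ * ((X + 1) ^ e₂ *
        (X ^ 2 + 1) ^ e₃)) * U ^ 2) * hA'
  exact ⟨c₁', c₃', e₁, e₂, e₃, e₄, U, W, hc₁.ne_zero, hc₃.ne_zero, hU, hW, h1, h2, h3, h4,
    by rw [hA]; ring, by rw [hA']; ring⟩

end LocalConditions

/-! ### Local conditions on the square classes -/

section TrivialClass

variable {A D A₂ A₃ Y U W : ℚ[X]} {c₁ c₃ : ℚ} {e₁ e₂ e₄ : ℕ}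

/-- The conditions at `r = 1` and `r = -1` make `c₃` and `(-1) ^ e₄ c₃` squares in `ℚ`, so that
`e₄ = 0`. -/
theorem isSquare_third_factor (hAD : IsCoprime A D) (hA₂ : A₂ = A + (X ^ 2 - 1) ^ 2 * D ^ 2)
    (hA₃ : A₃ = A + (X ^ 2 + 1) ^ 2 * D ^ 2) (hY : A * A₂ * A₃ = Y ^ 2)
    (hc₃ : c₃ ≠ 0) (hW : W ≠ 0) (he₄ : e₄ ≤ 1) (hA₃' : A₃ = C c₃ * X ^ e₄ * W ^ 2) :
    IsSquare A₃ := by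
  obtain ⟨Z, rfl⟩ : W ∣ Y := by
    rw [← IsIntegrallyClosed.pow_dvd_pow_iff (n := 2) two_ne_zero, ← hY, hA₃']
    exact ⟨A * A₂ * (C c₃ * X ^ e₄), by ring⟩
  have hZ : A * A₂ * (C c₃ * X ^ e₄) = Z ^ 2 :=
    mul_left_cancel₀ (pow_ne_zero 2 hW) (by rw [← mul_pow, ← hY, hA₃']; ring)
  -- At a root `t` of `r² - 1` the factors `A` and `A₂` agree.
  have key : ∀ t : ℚ, t ^ 2 = 1 → IsSquare (c₃ * t ^ e₄) := by
    intro t ht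
    have h2 := congrArg (eval t) hA₂
    have h3 := congrArg (eval t) hA₃
    have h3' := congrArg (eval t) hA₃'
    have hz := congrArg (eval t) hZ
    simp only [eval_add, eval_mul, eval_pow, eval_sub, eval_X, eval_one, eval_C, ht] at h2 h3 h3' hz
    by_cases hA0 : eval t A = 0
    · have hD : eval t D ≠ 0 := hAD.map_ne_zero_of_map_eq_zero (evalRingHom t) hA0
      refine isSquare_of_mul_sq_eq_sq (w := eval t W) (z := 2 * eval t D) ?_ ?_
      · intro h
        rw [h3', h, hA0] at h3
        have : (2 * eval t D) ^ 2 = 0 := by linear_combination -h3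
        simp [hD] at this
      · rw [← h3', h3, hA0]; ring
    · exact isSquare_of_mul_sq_eq_sq (w := eval t A) (z := eval t Z) hA0
        (by rw [← hz, h2]; ring)
  obtain ⟨d, hd⟩ : IsSquare c₃ := by simpa using key 1 (by norm_num)
  have h1 := key (-1) (by norm_num)
  have hd0 : d ≠ 0 := by rintro rfl; simp at hd; exact hc₃ hd
  interval_cases e₄
  · refine ⟨C d * W, ?_⟩
    rw [hA₃', hd, C_mul]; ring
  · obtain ⟨k, hk⟩ := h1
    rw [hd] at hk
    nlinarith [mul_self_pos.2 hd0, mul_self_nonneg k]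

/-- The condition at `r = 0`, where `A₂` and the square `A₃` agree: the remaining factor `G` of `A`
takes a value that is a square up to sign. -/
theorem isSquare_or_isSquare_neg_of_eval_zero (hAD : IsCoprime A D)
    (hA₂ : A₂ = A + (X ^ 2 - 1) ^ 2 * D ^ 2)
    (hA₃ : A₃ = A + (X ^ 2 + 1) ^ 2 * D ^ 2) (hA₃' : IsSquare A₃) {G : ℚ[X]}
    (hAU : A = G * U ^ 2) (hZ : G * A₂ = Y ^ 2) :
    IsSquare (eval 0 G) ∨ IsSquare (-eval 0 G) := by
  obtain ⟨V, hV⟩ := hA₃'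
  have h2 := congrArg (eval 0) hA₂
  have h3 := congrArg (eval 0) hA₃
  have hu := congrArg (eval 0) hAU
  have hv := congrArg (eval 0) hV
  have hz := congrArg (eval 0) hZ
  simp only [eval_add, eval_mul, eval_pow, eval_sub, eval_X, eval_one] at h2 h3 hu hv hz
  by_cases h0 : eval 0 V = 0
  · right
    rw [h0, h3] at hv
    have hU : eval 0 U ≠ 0 := by
      intro hU
      have hA0 : eval 0 A = 0 := by rw [hu, hU]; ring
      apply hAD.map_ne_zero_of_map_eq_zero (evalRingHom 0) hA0
      rw [hA0] at hv
      exact pow_eq_zero_iff two_ne_zero |>.1 (by simpa using hv)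
    refine isSquare_of_mul_sq_eq_sq (z := eval 0 D) hU ?_
    linear_combination hu - hv
  · left
    refine isSquare_of_mul_sq_eq_sq (z := eval 0 Y) h0 ?_
    linear_combination hz - eval 0 G * (h2 - h3 + hv)

theorem natDegree_X_sq_sub_one : (X ^ 2 - 1 : ℚ[X]).natDegree = 2 := by compute_degree!

theorem natDegree_X_sq_add_one : (X ^ 2 + 1 : ℚ[X]).natDegree = 2 := by compute_degree!

/-- The condition at infinity: if `A` had odd degree, its degree could not equal that of
`(X² ± 1)² D²`, and comparison of leading terms would give `A A₂` or `A₃` odd degree. -/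
theorem even_natDegree_of_isSquare_mul (hD : D ≠ 0) (hA : A ≠ 0) (hA₂ : A₂ = A + (X ^ 2 - 1) ^ 2 * D ^ 2)
    (hA₃ : A₃ = A + (X ^ 2 + 1) ^ 2 * D ^ 2) (hA₃' : IsSquare A₃) (hZ : IsSquare (A * A₂)) :
    Even A.natDegree := by
  obtain ⟨V, hV⟩ := hA₃'
  obtain ⟨Z, hZ⟩ := hZ
  have d1 : ((X ^ 2 - 1) ^ 2 * D ^ 2).natDegree = 4 + 2 * D.natDegree := by
    rw [natDegree_mul (pow_ne_zero _ fun h ↦ by simpa [h] using natDegree_X_sq_sub_one)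
      (pow_ne_zero _ hD), natDegree_pow, natDegree_pow, natDegree_X_sq_sub_one]
  have d2 : ((X ^ 2 + 1) ^ 2 * D ^ 2).natDegree = 4 + 2 * D.natDegree := by
    rw [natDegree_mul (pow_ne_zero _ fun h ↦ by simpa [h] using natDegree_X_sq_add_one)
      (pow_ne_zero _ hD), natDegree_pow, natDegree_pow, natDegree_X_sq_add_one]
  by_contra hodd
  have hne : A.natDegree ≠ 4 + 2 * D.natDegree := fun h ↦ hodd ⟨2 + D.natDegree, by omega⟩
  rcases lt_or_gt_of_ne hne with h | h
  · have h2 : A₂.natDegree = 4 + 2 * D.natDegree := by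
      rw [hA₂, natDegree_add_eq_right_of_natDegree_lt (by omega), d1]
    have hA20 : A₂ ≠ 0 := by rintro rfl; simp at h2; omega
    have := congrArg natDegree hZ
    rw [natDegree_mul hA hA20, h2, ← pow_two, natDegree_pow] at this
    exact hodd ⟨Z.natDegree - 2 - D.natDegree, by omega⟩
  · have h3 : A₃.natDegree = A.natDegree := by
      rw [hA₃, natDegree_add_eq_left_of_natDegree_lt (by omega)]
    rw [hV, ← pow_two, natDegree_pow] at h3
    exact hodd ⟨V.natDegree, by omega⟩

/-- The condition at `r = i`, where `X² - 1` takes the value `-2`, not a square up to sign in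
`ℚ(i)`. -/
theorem not_eq_mul_X_sq_sub_one (hAD : IsCoprime A D) (hA₂ : A₂ = A + (X ^ 2 - 1) ^ 2 * D ^ 2)
    (hA₃ : A₃ = A + (X ^ 2 + 1) ^ 2 * D ^ 2) (hA₃' : IsSquare A₃) {σ : ℚ}
    (hσ : σ = 1 ∨ σ = -1) (hAU : A = C σ * (X ^ 2 - 1) * U ^ 2)
    (hZ : C σ * (X ^ 2 - 1) * A₂ = Y ^ 2) : False := by
  obtain ⟨V, hV⟩ := hA₃'
  have h2 := congrArg (aeval Complex.I) hA₂
  have h3 := congrArg (aeval Complex.I) hA₃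
  have hu := congrArg (aeval Complex.I) hAU
  have hv := congrArg (aeval Complex.I) hV
  have hz := congrArg (aeval Complex.I) hZ
  simp only [map_add, map_mul, map_pow, map_sub, aeval_X, map_one, aeval_C, Complex.I_sq,
    eq_ratCast] at h2 h3 hu hv hz
  have hσ' : -2 * σ = 2 ∨ -2 * σ = -2 := by rcases hσ with rfl | rfl <;> norm_num
  have hU : aeval Complex.I U = 0 := aeval_I_eq_zero_of_sq_eq (f := V) hσ' (by
    push_cast; linear_combination hu + h3 - hv)
  have hA : aeval Complex.I A = 0 := by rw [hu, hU]; ring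
  have hD : aeval Complex.I D = 0 := by
    have := aeval_I_eq_zero_of_sq_eq (f := Y) (g := 2 * D) hσ' (by
      rw [map_mul, map_ofNat]
      push_cast; linear_combination -hz - 2 * σ * (h2 + hA))
    simpa [map_mul, map_ofNat] using this
  exact hAD.map_ne_zero_of_map_eq_zero (aeval Complex.I : ℚ[X] →ₐ[ℚ] ℂ).toRingHom hA hD

/-- The local conditions combined: if `X² + 1` has even exponent in the square classes, then `A` is a
square up to sign and `A₃` is a square. -/
theorem isSquare_or_neg_and_isSquare (hAD : IsCoprime A D) (hD : D ≠ 0)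
    (hA₂ : A₂ = A + (X ^ 2 - 1) ^ 2 * D ^ 2)
    (hA₃ : A₃ = A + (X ^ 2 + 1) ^ 2 * D ^ 2) (hY : A * A₂ * A₃ = Y ^ 2)
    (hc₁ : c₁ ≠ 0) (hc₃ : c₃ ≠ 0) (hU : U ≠ 0) (hW : W ≠ 0)
    (he₁ : e₁ ≤ 1) (he₂ : e₂ ≤ 1) (he₄ : e₄ ≤ 1)
    (hA : A = C c₁ * (X - 1) ^ e₁ * (X + 1) ^ e₂ * U ^ 2)
    (hA₃W : A₃ = C c₃ * X ^ e₄ * W ^ 2) :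
    (IsSquare A ∨ IsSquare (-A)) ∧ IsSquare A₃ := by
  have hs := isSquare_third_factor hAD hA₂ hA₃ hY hc₃ hW he₄ hA₃W
  refine ⟨?_, hs⟩
  have hA₃0 : A₃ ≠ 0 := by
    rw [hA₃W]
    exact mul_ne_zero (mul_ne_zero (C_ne_zero.2 hc₃) (pow_ne_zero _ X_ne_zero)) (pow_ne_zero _ hW)
  have hp := prime_X_sub_one.ne_zero
  have hq := prime_X_add_one.ne_zero
  set G : ℚ[X] := C c₁ * (X - 1) ^ e₁ * (X + 1) ^ e₂ with hG
  have hG0 : G ≠ 0 := mul_ne_zero (mul_ne_zero (C_ne_zero.2 hc₁) (pow_ne_zero _ hp))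
    (pow_ne_zero _ hq)
  have hA0 : A ≠ 0 := hA ▸ mul_ne_zero hG0 (pow_ne_zero _ hU)
  obtain ⟨V, hV⟩ := id hs
  have hV0 : V ≠ 0 := by rintro rfl; exact hA₃0 (by rw [hV]; ring)
  obtain ⟨Z, rfl⟩ : U * V ∣ Y := by
    rw [← IsIntegrallyClosed.pow_dvd_pow_iff (n := 2) two_ne_zero, ← hY, hA, hV]
    exact ⟨G * A₂, by ring⟩
  have hZ : G * A₂ = Z ^ 2 :=
    mul_left_cancel₀ (pow_ne_zero 2 (mul_ne_zero hU hV0)) (by rw [← mul_pow, ← hY, hA, hV]; ring)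
  have hdeg := even_natDegree_of_isSquare_mul hD hA0 hA₂ hA₃ hs ⟨U * Z, by
    linear_combination A₂ * hA + U ^ 2 * hZ⟩
  have hsum : Even (e₁ + e₂) := by
    rw [hA, natDegree_mul hG0 (pow_ne_zero _ hU), hG, natDegree_mul
      (mul_ne_zero (C_ne_zero.2 hc₁) (pow_ne_zero _ hp)) (pow_ne_zero _ hq), natDegree_C_mul hc₁,
      natDegree_pow, natDegree_pow, natDegree_pow, show (X - 1 : ℚ[X]).natDegree = 1 by
        compute_degree!, show (X + 1 : ℚ[X]).natDegree = 1 by compute_degree!] at hdeg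
    simpa [Nat.even_add] using hdeg
  have hev : eval 0 G = c₁ * (-1) ^ e₁ := by simp [hG]
  have h0 := isSquare_or_isSquare_neg_of_eval_zero hAD hA₂ hA₃ hs hA hZ
  rw [hev] at h0
  have hc : ∃ σ d : ℚ, d ≠ 0 ∧ (σ = 1 ∨ σ = -1) ∧ c₁ = σ * d ^ 2 := by
    have : IsSquare c₁ ∨ IsSquare (-c₁) := by
      interval_cases e₁
      · simpa using h0
      · simpa using h0.symm
    rcases this with ⟨d, hd⟩ | ⟨d, hd⟩
    · exact ⟨1, d, by rintro rfl; simp at hd; exact hc₁ hd, by simp, by rw [hd]; ring⟩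
    · exact ⟨-1, d, by rintro rfl; simp at hd; exact hc₁ hd, by simp, by linear_combination -hd⟩
  obtain ⟨σ, d, hd0, hσ, rfl⟩ := hc
  have : (e₁ = 0 ∧ e₂ = 0) ∨ (e₁ = 1 ∧ e₂ = 1) := by
    obtain ⟨k, hk⟩ := hsum
    omega
  rcases this with ⟨rfl, rfl⟩ | ⟨rfl, rfl⟩
  · rcases hσ with rfl | rfl
    · exact Or.inl ⟨C d * U, by rw [hA, hG]; simp only [map_mul, map_pow, map_one]; ring⟩
    · exact Or.inr ⟨C d * U, by rw [hA, hG]; simp only [map_mul, map_pow, map_one, map_neg]; ring⟩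
  · refine (not_eq_mul_X_sq_sub_one (U := C d * U) (Y := C (1 / d) * Z) hAD hA₂ hA₃ hs hσ ?_
      ?_).elim
    · rw [hA, hG]; simp only [map_mul, map_pow]; ring
    · rw [mul_pow, ← hZ, hG]
      have : (C (1 / d) * C d : ℚ[X]) = 1 := by
        rw [← C_mul, one_div_mul_cancel hd0, C_1]
      simp only [map_mul, map_pow]
      linear_combination -(C σ * (X ^ 2 - 1) * A₂) * (C (1 / d) * C d + 1) * this

end TrivialClass

/-! ### Points in lowest terms -/

section WeakMordellWeil

local notation "K" => RatFunc ℚ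
local notation "ι" => algebraMap ℚ[X] (RatFunc ℚ)

instance isElliptic_curveE_X : (curveE (RatFunc.X : K)).IsElliptic := by
  refine ⟨isUnit_iff_ne_zero.2 ?_⟩
  rw [curveE_Δ]
  have h : (16 * (2 * X * (X ^ 2 - 1) * (X ^ 2 + 1)) ^ 4 : ℚ[X]) ≠ 0 := by
    intro h
    have := congrArg (eval 2) h
    norm_num at this
  have := (map_ne_zero_iff ι (IsFractionRing.injective _ _)).2 h
  simpa [RatFunc.algebraMap_X] using this

theorem exists_eq_algebraMap_of_sq_eq {z : K} {f : ℚ[X]} (h : z ^ 2 = ι f) : ∃ g, z = ι g := by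
  obtain ⟨g, hg⟩ := IsIntegrallyClosed.exists_algebraMap_eq_of_isIntegral_pow
    (R := ℚ[X]) (x := z) two_pos (h ▸ isIntegral_algebraMap)
  exact ⟨g, hg.symm⟩

/-- The coordinates of an affine point in lowest terms, with `x` centred at the root `r⁴ + 1`. The
denominator is a square because it is coprime to the numerator of the cubic, and their product is a
square. -/
theorem exists_lowest_terms {x y : K} (h : (curveE (RatFunc.X : K)).toAffine.Equation x y) :
    ∃ A D Y : ℚ[X], IsCoprime A D ∧ D ≠ 0 ∧
      x - (RatFunc.X ^ 4 + 1) = ι A / ι D ^ 2 ∧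
      A * (A + (X ^ 2 - 1) ^ 2 * D ^ 2) * (A + (X ^ 2 + 1) ^ 2 * D ^ 2) = Y ^ 2 ∧
      y = ι Y / ι D ^ 3 := by
  rw [curveE_equation_iff] at h
  obtain ⟨N, B, hNB, hB, hx⟩ : ∃ N B : ℚ[X], IsCoprime N B ∧ B ≠ 0 ∧
      x - (RatFunc.X ^ 4 + 1) = ι N / ι B :=
    ⟨_, _, RatFunc.isCoprime_num_denom _, RatFunc.denom_ne_zero _, (RatFunc.num_div_denom _).symm⟩
  have inj := RatFunc.algebraMap_injective ℚ
  have hB' : ι B ≠ 0 := (map_ne_zero_iff ι inj).2 hB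
  obtain rfl : x = ι N / ι B + (RatFunc.X ^ 4 + 1) := by rw [← hx]; ring
  obtain ⟨Z, hZ⟩ := exists_eq_algebraMap_of_sq_eq (z := y * ι B ^ 2)
    (f := B * (N * (N + (X ^ 2 - 1) ^ 2 * B) * (N + (X ^ 2 + 1) ^ 2 * B))) (by
      simp only [map_mul, map_add, map_sub, map_pow, map_one, RatFunc.algebraMap_X]
      rw [mul_pow, h]
      field_simp
      ring)
  have hZ2 : B * (N * (N + (X ^ 2 - 1) ^ 2 * B) * (N + (X ^ 2 + 1) ^ 2 * B)) = Z ^ 2 := by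
    apply inj
    rw [map_pow, ← hZ, mul_pow, h]
    simp only [map_mul, map_add, map_sub, map_pow, map_one, RatFunc.algebraMap_X]
    field_simp
    ring
  have hco : ∀ g : ℚ[X], IsCoprime B (N + g * B) := fun g ↦
    (IsCoprime.add_mul_right_right_iff ..).2 hNB.symm
  obtain ⟨D, u, hu⟩ := exists_associated_pow_of_mul_eq_pow'
    ((hNB.symm.mul_right (hco _)).mul_right (hco _)) hZ2
  have hD : D ≠ 0 := by rintro rfl; simp at hu; exact hB hu.symm
  have hD' : ι D ≠ 0 := (map_ne_zero_iff ι inj).2 hD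
  have huu : (u : ℚ[X]) * ((u⁻¹ : ℚ[X]ˣ) : ℚ[X]) = 1 := Units.mul_inv u
  have hu' : ι (u : ℚ[X]) * ι ((u⁻¹ : ℚ[X]ˣ) : ℚ[X]) = 1 := by rw [← map_mul, huu, map_one]
  have hu0 : ι (u : ℚ[X]) ≠ 0 := left_ne_zero_of_mul_eq_one hu'
  have hx' : ι N / ι B = ι (((u⁻¹ : ℚ[X]ˣ) : ℚ[X]) * N) / ι D ^ 2 := by
    rw [← hu, map_mul, map_mul, map_pow, div_eq_div_iff (by positivity) (by positivity)]
    linear_combination -ι N * ι D ^ 2 * hu'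
  have hAD : IsCoprime (((u⁻¹ : ℚ[X]ˣ) : ℚ[X]) * N) D := by
    rw [isCoprime_mul_unit_left_left (Units.isUnit _)]
    refine hNB.of_isCoprime_of_dvd_right ?_
    rw [← hu, pow_two, mul_assoc]
    exact dvd_mul_right _ _
  rw [hx'] at h ⊢
  generalize ((u⁻¹ : ℚ[X]ˣ) : ℚ[X]) * N = A at *
  have hy : (y * ι D ^ 3) ^ 2 = ι (A * (A + (X ^ 2 - 1) ^ 2 * D ^ 2) *
      (A + (X ^ 2 + 1) ^ 2 * D ^ 2)) := by
    rw [mul_pow, h]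
    simp only [map_mul, map_add, map_sub, map_pow, map_one, RatFunc.algebraMap_X]
    field_simp
    ring
  obtain ⟨Y, hY⟩ := exists_eq_algebraMap_of_sq_eq hy
  refine ⟨A, D, Y, hAD, hD, by ring, ?_, by field_simp; exact hY⟩
  apply inj
  rw [← hy, hY, map_pow]

end WeakMordellWeil

/-! ### Generation by torsion modulo doubles -/

section WeakMordellWeil

local notation "K" => RatFunc ℚ
local notation "ι" => algebraMap ℚ[X] (RatFunc ℚ)

/-- The square class of `ξ` involves `r² + 1` to an odd power and otherwise only constants, `r - 1`
and `r + 1`. -/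
def HasOddClass (ξ : K) : Prop :=
  ∃ (c : ℚ) (e₁ e₂ : ℕ) (U D : ℚ[X]), c ≠ 0 ∧ U ≠ 0 ∧ D ≠ 0 ∧
    ξ = ι (C c * (X - 1) ^ e₁ * (X + 1) ^ e₂ * (X ^ 2 + 1) * U ^ 2) / ι D ^ 2

/-- Multiplication by `r⁴ - 1` changes the parity of the exponent of `r² + 1`. -/
theorem HasOddClass.false_of_isSquare {ξ η : K} (hξ : HasOddClass ξ) (hη : HasOddClass η)
    (h : IsSquare (ξ * (RatFunc.X ^ 4 - 1) * η)) : False := by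
  obtain ⟨c, e₁, e₂, U, D, hc, hU, hD, rfl⟩ := hξ
  obtain ⟨c', e₁', e₂', U', D', hc', hU', hD', rfl⟩ := hη
  obtain ⟨z, hz⟩ := h
  have inj := RatFunc.algebraMap_injective ℚ
  have hD0 : ι D ≠ 0 := (map_ne_zero_iff ι inj).2 hD
  have hD0' : ι D' ≠ 0 := (map_ne_zero_iff ι inj).2 hD'
  have key : (z * ι D * ι D') ^ 2 = ι ((X ^ 2 + 1) ^ 3 * (C c * C c' * (X - 1) ^ (e₁ + e₁' + 1) *
      (X + 1) ^ (e₂ + e₂' + 1)) * (U * U') ^ 2) := by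
    rw [mul_pow, mul_pow, pow_two z, ← hz]
    simp only [map_mul, map_add, map_sub, map_pow, map_one, RatFunc.algebraMap_X]
    field_simp
    ring
  obtain ⟨Z, hZ⟩ := exists_eq_algebraMap_of_sq_eq key
  rw [hZ, ← map_pow] at key
  have hb := prime_X_sq_add_one
  have := hb.even_of_pow_mul_mul_sq_eq_sq ?_ (mul_ne_zero hU hU') (inj key).symm
  · revert this; decide
  · intro h
    refine hb.not_isUnit (IsCoprime.isUnit_of_dvd' ?_ dvd_rfl h)
    have hu : ∀ {c : ℚ}, c ≠ 0 → IsCoprime (X ^ 2 + 1 : ℚ[X]) (C c) := fun h ↦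
      (isCoprime_one_right.of_isCoprime_of_dvd_right (isUnit_C.2 (isUnit_iff_ne_zero.2 h)).dvd)
    exact (((hu hc).mul_right (hu hc')).mul_right
      isCoprime_X_sq_add_one_X_sub_one.pow_right).mul_right
      isCoprime_X_sq_add_one_X_add_one.pow_right

theorem hasOddClass_or {x y : K} (h : (curveE (RatFunc.X : K)).toAffine.Equation x y)
    (hy : y ≠ 0) :
    HasOddClass (x - (RatFunc.X ^ 4 + 1)) ∨
      (IsSquare (x - (RatFunc.X ^ 4 + 1)) ∨ IsSquare (-(x - (RatFunc.X ^ 4 + 1)))) ∧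
        IsSquare (x + 2 * RatFunc.X ^ 2) := by
  obtain ⟨A, D, Y, hAD, hD, hx, hY, rfl⟩ := exists_lowest_terms h
  have inj := RatFunc.algebraMap_injective ℚ
  have hD0 : ι D ≠ 0 := (map_ne_zero_iff ι inj).2 hD
  have hY0 : Y ≠ 0 := by rintro rfl; simp at hy
  obtain ⟨c₁, c₃, e₁, e₂, e₃, e₄, U, W, hc₁, hc₃, hU, hW, h1, h2, h3, h4, hA, hA3⟩ :=
    exists_square_classes hAD rfl rfl hY hY0
  have hx3 : x + 2 * RatFunc.X ^ 2 = ι (A + (X ^ 2 + 1) ^ 2 * D ^ 2) / ι D ^ 2 := by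
    rw [show x + 2 * RatFunc.X ^ 2 = x - (RatFunc.X ^ 4 + 1) + (RatFunc.X ^ 2 + 1) ^ 2 by ring, hx]
    simp only [map_mul, map_add, map_pow, map_one, RatFunc.algebraMap_X]
    field_simp
  have hdiv : ∀ f : ℚ[X], IsSquare f → IsSquare (ι f / ι D ^ 2) := fun f hf ↦
    (hf.map ι).div (IsSquare.sq _)
  interval_cases e₃
  · right
    rw [hx, hx3, ← neg_div, ← map_neg]
    have := isSquare_or_neg_and_isSquare hAD hD rfl rfl hY hc₁ hc₃ hU hW h1 h2 h4 (by simpa using hA)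
      (by simpa using hA3)
    exact ⟨this.1.imp (hdiv _) (hdiv _), hdiv _ this.2⟩
  · left
    exact ⟨c₁, e₁, e₂, U, D, hc₁, hU, hD, by rw [hx]; nth_rw 1 [hA]; rw [pow_one]⟩

theorem isSquare_of_isSquare_mul {F : Type*} [Field F] {u k v : F} (hu : IsSquare u) (hu0 : u ≠ 0)
    (hk : k ≠ 0) (h : IsSquare (u * k ^ 2 * v)) : IsSquare v := by
  obtain ⟨s, rfl⟩ := hu
  have hs : s ≠ 0 := left_ne_zero_of_mul hu0
  obtain ⟨z, hz⟩ := h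
  exact ⟨z / (s * k), by field_simp; linear_combination hz⟩

theorem nonsingular_four :
    (curveE (RatFunc.X : K)).toAffine.Nonsingular (2 * RatFunc.X ^ 4)
      (2 * RatFunc.X ^ 2 * (RatFunc.X ^ 4 - 1)) := by
  rw [← Affine.equation_iff_nonsingular, curveE_equation_iff]; ring

theorem nonsingular_two :
    (curveE (RatFunc.X : K)).toAffine.Nonsingular (2 * RatFunc.X ^ 2) 0 := by
  rw [← Affine.equation_iff_nonsingular, curveE_equation_iff]; ring

theorem ratFunc_ne_zero_of_eval {f : ℚ[X]} (t : ℚ) (h : eval t f ≠ 0) : ι f ≠ 0 :=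
  (map_ne_zero_iff ι (RatFunc.algebraMap_injective ℚ)).2 fun h0 ↦ h (by rw [h0, eval_zero])

/-- The root `r⁴ + 1` of the cubic, at which the coordinate `x` is centred in the descent. -/
theorem nonsingular_root :
    (curveE (RatFunc.X : K)).toAffine.Nonsingular (RatFunc.X ^ 4 + 1) 0 := by
  rw [← Affine.equation_iff_nonsingular, curveE_equation_iff]; ring

/-- The root `-2r²` of the cubic. -/
theorem nonsingular_root' :
    (curveE (RatFunc.X : K)).toAffine.Nonsingular (-2 * RatFunc.X ^ 2) 0 := by
  rw [← Affine.equation_iff_nonsingular, curveE_equation_iff]; ring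

theorem factors_ne_zero {x y : K} (h : (curveE (RatFunc.X : K)).toAffine.Equation x y)
    (hy : y ≠ 0) : x - (RatFunc.X ^ 4 + 1) ≠ 0 ∧ x - 2 * RatFunc.X ^ 2 ≠ 0 ∧
      x + 2 * RatFunc.X ^ 2 ≠ 0 := by
  rw [curveE_equation_iff] at h
  have := pow_ne_zero 2 hy
  rw [h, sub_sub, mul_ne_zero_iff, mul_ne_zero_iff] at this
  exact ⟨this.2, this.1.2, this.1.1⟩

theorem four_Y_ne_zero : (2 * (2 * RatFunc.X ^ 2 * (RatFunc.X ^ 4 - 1)) : K) ≠ 0 := by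
  have := ratFunc_ne_zero_of_eval (f := 2 * (2 * X ^ 2 * (X ^ 4 - 1))) 2 (by norm_num)
  simpa [RatFunc.algebraMap_X] using this

variable [DecidableEq K]

/-- A point of order four. -/
noncomputable def pointFour : (curveE (RatFunc.X : K)).toAffine.Point := .some _ _ nonsingular_four

/-- The point `(2r², 0)` of order two, which is not a multiple of `pointFour`. -/
noncomputable def pointTwo : (curveE (RatFunc.X : K)).toAffine.Point := .some _ _ nonsingular_two

theorem pointTwo_add_self : pointTwo + pointTwo = 0 :=
  Affine.Point.add_self_of_Y_eq (by rw [curveE_negY, neg_zero])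

theorem add_self_eq_zero_of_Y_eq_zero {x : K}
    (h : (curveE (RatFunc.X : K)).toAffine.Nonsingular x 0) :
    Affine.Point.some x 0 h + .some x 0 h = 0 :=
  Affine.Point.add_self_of_Y_eq (by rw [curveE_negY, neg_zero])

theorem pointFour_add_self : pointFour + pointFour = .some _ _ nonsingular_root := by
  obtain h | ⟨x, y, hn, h⟩ : pointFour + pointFour = 0 ∨ ∃ x y hn,
      pointFour + pointFour = .some x y hn := by
    cases pointFour + pointFour with
    | zero => exact Or.inl rfl
    | some x y h => exact Or.inr ⟨x, y, h, rfl⟩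
  · rw [← eq_neg_iff_add_eq_zero, pointFour, Affine.Point.neg_some, Affine.Point.some.injEq,
      curveE_negY] at h
    exact absurd (by linear_combination h.2) four_Y_ne_zero
  · obtain ⟨h0, h1, -⟩ := double_X nonsingular_four hn h
    have h2 : (x - (RatFunc.X ^ 4 + 1)) * (2 * (2 * RatFunc.X ^ 2 * (RatFunc.X ^ 4 - 1))) ^ 2 = 0 := by
      rw [h1]; ring
    obtain rfl : x = RatFunc.X ^ 4 + 1 :=
      sub_eq_zero.1 ((mul_eq_zero.1 h2).resolve_right (pow_ne_zero 2 h0))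
    have hE := (curveE_equation_iff _ _ _).1 hn.1
    obtain rfl : y = 0 := by
      rw [← pow_eq_zero_iff two_ne_zero, hE]; ring
    exact h

theorem root_add_pointTwo :
    (.some _ _ nonsingular_root : (curveE (RatFunc.X : K)).toAffine.Point) + pointTwo =
      .some _ _ nonsingular_root' := by
  have hne : (RatFunc.X ^ 4 + 1 : K) ≠ 2 * RatFunc.X ^ 2 := by
    have := ratFunc_ne_zero_of_eval (f := X ^ 4 + 1 - 2 * X ^ 2) 2 (by norm_num)
    rw [← sub_ne_zero]
    simpa [RatFunc.algebraMap_X, map_ofNat] using this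
  rw [pointTwo, Affine.Point.add_of_X_ne hne, Affine.Point.some.injEq,
    Affine.slope_of_X_ne hne]
  constructor
  · simp [Affine.addX, curveE]
  · simp [Affine.addY, Affine.negY, Affine.negAddY, Affine.addX, curveE]

/-- The subgroup generated by `pointFour` and `pointTwo`; it turns out to be the whole group. -/
noncomputable def torsionGroup : AddSubgroup (curveE (RatFunc.X : K)).toAffine.Point :=
  AddSubgroup.closure {pointFour, pointTwo}

theorem pointFour_mem : pointFour ∈ torsionGroup := AddSubgroup.subset_closure (by simp)

theorem pointTwo_mem : pointTwo ∈ torsionGroup := AddSubgroup.subset_closure (by simp)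

theorem mem_torsionGroup_of_Y_eq_zero {x : K}
    (h : (curveE (RatFunc.X : K)).toAffine.Nonsingular x 0) :
    .some x 0 h ∈ torsionGroup := by
  have hr : .some _ _ nonsingular_root ∈ torsionGroup :=
    pointFour_add_self ▸ add_mem pointFour_mem pointFour_mem
  have hE := (curveE_equation_iff _ _ _).1 h.1
  rw [zero_pow two_ne_zero, eq_comm, mul_eq_zero, mul_eq_zero] at hE
  rcases hE with (hE | hE) | hE
  · obtain rfl : x = -2 * RatFunc.X ^ 2 := by linear_combination hE
    exact root_add_pointTwo ▸ add_mem hr pointTwo_mem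
  · obtain rfl : x = 2 * RatFunc.X ^ 2 := by linear_combination hE
    exact pointTwo_mem
  · obtain rfl : x = RatFunc.X ^ 4 + 1 := by linear_combination hE
    exact hr

theorem exists_add_self_of_isSquare {x y : K}
    (h : (curveE (RatFunc.X : K)).toAffine.Nonsingular x y) (hy : y ≠ 0)
    (h1 : IsSquare (x - (RatFunc.X ^ 4 + 1))) (h3 : IsSquare (x + 2 * RatFunc.X ^ 2)) :
    ∃ Q : (curveE (RatFunc.X : K)).toAffine.Point, Q + Q = .some x y h := by
  obtain ⟨h10, -, h30⟩ := factors_ne_zero h.1 hy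
  have h2 : IsSquare (x - 2 * RatFunc.X ^ 2) := by
    refine isSquare_of_isSquare_mul (h1.mul h3) (mul_ne_zero h10 h30) one_ne_zero ⟨y, ?_⟩
    have hE := (curveE_equation_iff _ _ _).1 h.1
    linear_combination -hE
  obtain ⟨p, hp⟩ := h1
  obtain ⟨q, hq⟩ := h2
  obtain ⟨s, hs⟩ := h3
  exact exists_add_self_eq h (hp.trans (pow_two p).symm) (hq.trans (pow_two q).symm)
    (hs.trans (pow_two s).symm)

theorem eq_some_or_mem (P : (curveE (RatFunc.X : K)).toAffine.Point) :
    P ∈ torsionGroup ∨ ∃ x y h, y ≠ 0 ∧ P = .some x y h := by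
  cases P with
  | zero => exact Or.inl (zero_mem _)
  | some x y h =>
    by_cases hy : y = 0
    · subst hy; exact Or.inl (mem_torsionGroup_of_Y_eq_zero h)
    · exact Or.inr ⟨x, y, h, hy, rfl⟩

/-- A point whose classes are `±1` and `1` is twice a point after a translation by a torsion
point. -/
theorem exists_sub_eq_add_self_of_isSquare {x y : K}
    (h : (curveE (RatFunc.X : K)).toAffine.Nonsingular x y) (hy : y ≠ 0)
    (h1 : IsSquare (x - (RatFunc.X ^ 4 + 1)) ∨ IsSquare (-(x - (RatFunc.X ^ 4 + 1))))
    (h3 : IsSquare (x + 2 * RatFunc.X ^ 2)) :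
    ∃ t ∈ torsionGroup, ∃ Q, Affine.Point.some x y h = t + (Q + Q) := by
  rcases h1 with h1 | h1
  · obtain ⟨Q, hQ⟩ := exists_add_self_of_isSquare h hy h1 h3
    exact ⟨0, zero_mem _, Q, by rw [hQ, zero_add]⟩
  -- Adding the point `(2r², 0)` changes the sign of the first class, as `2r² - (r⁴ + 1)` is minus a
  -- square, and preserves the third, as `2r² + 2r²` is a square.
  rcases eq_some_or_mem (.some x y h + pointTwo) with hP | ⟨x', y', h', hy', hP⟩
  · exact ⟨.some x y h, by simpa using sub_mem hP pointTwo_mem, 0, by simp⟩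
  obtain ⟨h10, -, h30⟩ := factors_ne_zero h.1 hy
  have hk : (RatFunc.X ^ 2 - 1 : K) ≠ 0 := by
    have := ratFunc_ne_zero_of_eval (f := X ^ 2 - 1) 2 (by norm_num)
    simpa [RatFunc.algebraMap_X] using this
  have hk' : (2 * RatFunc.X : K) ≠ 0 := by simp [RatFunc.X_ne_zero]
  obtain ⟨Q, hQ⟩ := exists_add_self_of_isSquare h' hy'
    (isSquare_of_isSquare_mul h1 (neg_ne_zero.2 h10) hk (by
      convert isSquare_of_add_eq h nonsingular_two h' hP nonsingular_root.1 using 1; ring))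
    (isSquare_of_isSquare_mul h3 h30 hk' (by
      convert isSquare_of_add_eq h nonsingular_two h' hP nonsingular_root'.1 using 1; ring))
  exact ⟨-pointTwo, neg_mem pointTwo_mem, Q, by rw [hQ, ← hP]; abel⟩

/-- The group is generated by the two torsion points modulo doubles: adding `pointFour` removes the
factor `r² + 1` from the square classes, and the local conditions then leave only a sign. -/
theorem exists_eq_torsion_add_add_self (P : (curveE (RatFunc.X : K)).toAffine.Point) :
    ∃ t ∈ torsionGroup, ∃ Q, P = t + (Q + Q) := by
  rcases eq_some_or_mem P with hP | ⟨x, y, h, hy, rfl⟩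
  · exact ⟨P, hP, 0, by simp⟩
  rcases hasOddClass_or h.1 hy with ho | ⟨h1, h3⟩
  · rcases eq_some_or_mem (.some x y h + pointFour) with hP | ⟨x', y', h', hy', hP⟩
    · exact ⟨.some x y h, by simpa using sub_mem hP pointFour_mem, 0, by simp⟩
    rcases hasOddClass_or h'.1 hy' with ho' | ⟨h1, h3⟩
    · refine (ho.false_of_isSquare ho' ?_).elim
      have := isSquare_of_add_eq h nonsingular_four h' hP nonsingular_root.1
      rwa [show (2 * RatFunc.X ^ 4 - (RatFunc.X ^ 4 + 1) : K) = RatFunc.X ^ 4 - 1 by ring] at this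
    · obtain ⟨t, ht, Q, hQ⟩ := exists_sub_eq_add_self_of_isSquare h' hy' h1 h3
      exact ⟨t - pointFour, sub_mem ht pointFour_mem, Q, by
        rw [sub_add_eq_add_sub, ← hQ, ← hP]; abel⟩
  · exact exists_sub_eq_add_self_of_isSquare h hy h1 h3

end WeakMordellWeil

/-! ### Doubling in terms of square presentations -/

section Descent

local notation "K" => RatFunc ℚ
local notation "ι" => algebraMap ℚ[X] (RatFunc ℚ)

/-- The local form of the statement that doubling kills the component of a fibre of type `I₄` met by
the double of a point. The quotient `m / n` in lowest terms is the square root of `x(2P) - e`, for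
`(c / d)² = x(P) - e`, and `p` is a prime at which the curve reduces to a nodal cubic with its node
at `e`; then `2P` does not reduce to the node. -/
theorem Prime.not_dvd_of_double {R : Type*} [CommRing R] [IsDomain R] {p c d e f g h m n : R}
    (hp : Prime p) (hmn : IsCoprime m n) (hd : ¬p ∣ d) (hh : ¬p ∣ h)
    (he : e ^ 2 = c ^ 2 + p ^ 2 * g * d ^ 2)
    (H : m * (2 * c * d * e * f) = n * (c ^ 4 - p ^ 2 * h * d ^ 4)) : ¬p ∣ m := by
  intro hm
  have hn : ¬p ∣ n := fun hn ↦ hp.not_isUnit (hmn.isUnit_of_dvd' hm hn)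
  by_cases hc : p ∣ c
  · obtain ⟨c', rfl⟩ := hc
    obtain ⟨e', rfl⟩ : p ∣ e := by
      refine hp.dvd_of_dvd_pow (n := 2) ?_
      rw [he]
      exact ⟨p * c' ^ 2 + p * g * d ^ 2, by ring⟩
    have H' : m * (2 * c' * d * e' * f) = n * (p ^ 2 * c' ^ 4 - h * d ^ 4) :=
      mul_left_cancel₀ (pow_ne_zero 2 hp.ne_zero) (by linear_combination H)
    have h1 := (hp.dvd_or_dvd (H' ▸ hm.mul_right _)).resolve_left hn
    rw [dvd_sub_right (Dvd.intro_left _ (by rw [pow_two]; ring : (p * c' ^ 4) * p = _))] at h1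
    exact (hp.dvd_or_dvd h1).elim hh fun h ↦ hd (hp.dvd_of_dvd_pow h)
  · have h1 := (hp.dvd_or_dvd (H ▸ hm.mul_right _)).resolve_left hn
    rw [dvd_sub_left (Dvd.intro_left _ (by ring : (p * h * d ^ 4) * p = _))] at h1
    exact hc (hp.dvd_of_dvd_pow h1)

/-- The linear factors at `x` are the squares of `A / D`, `B / D` and `C / D`, with `A / D` in lowest
terms: this is the shape of the `x`-coordinate of twice a point. The fractions determine the
polynomials only up to a common constant and the signs of `A`, `B`, `C`. -/
structure IsSquarePresentation (x : K) (A D B C : ℚ[X]) : Prop where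
  coprime : IsCoprime A D
  ne_zero : D ≠ 0
  eq : x - (RatFunc.X ^ 4 + 1) = (ι A / ι D) ^ 2
  sq₂ : B ^ 2 = A ^ 2 + (X ^ 2 - 1) ^ 2 * D ^ 2
  sq₃ : C ^ 2 = A ^ 2 + (X ^ 2 + 1) ^ 2 * D ^ 2

theorem exists_isSquarePresentation {x ξ η : K} (hξ : x - (RatFunc.X ^ 4 + 1) = ξ ^ 2)
    (hη : x - 2 * RatFunc.X ^ 2 = η ^ 2) (h : IsSquare (x + 2 * RatFunc.X ^ 2)) :
    ∃ A D B C, IsSquarePresentation x A D B C ∧ ξ = ι A / ι D ∧ η = ι B / ι D := by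
  have hD : RatFunc.denom ξ ≠ 0 := RatFunc.denom_ne_zero ξ
  have hξ' := RatFunc.num_div_denom ξ
  have hco := RatFunc.isCoprime_num_denom ξ
  generalize RatFunc.denom ξ = D at *
  generalize RatFunc.num ξ = A at *
  subst hξ'
  have inj := RatFunc.algebraMap_injective ℚ
  have hD0 : ι D ≠ 0 := (map_ne_zero_iff ι inj).2 hD
  obtain ⟨ζ, hζ⟩ := h
  obtain rfl : x = (ι A / ι D) ^ 2 + (RatFunc.X ^ 4 + 1) := by rw [← hξ]; ring
  have h2 : (η * ι D) ^ 2 = ι (A ^ 2 + (X ^ 2 - 1) ^ 2 * D ^ 2) := by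
    rw [mul_pow, ← hη]
    simp only [map_mul, map_add, map_sub, map_pow, map_one, RatFunc.algebraMap_X]
    field_simp
    ring
  have h3 : (ζ * ι D) ^ 2 = ι (A ^ 2 + (X ^ 2 + 1) ^ 2 * D ^ 2) := by
    rw [mul_pow, pow_two ζ, ← hζ]
    simp only [map_mul, map_add, map_pow, map_one, RatFunc.algebraMap_X]
    field_simp
    ring
  obtain ⟨B, hB⟩ := exists_eq_algebraMap_of_sq_eq h2
  obtain ⟨C, hC⟩ := exists_eq_algebraMap_of_sq_eq h3
  refine ⟨A, D, B, C, ⟨hco, hD, hξ, inj ?_, inj ?_⟩, rfl, ?_⟩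
  · rw [← h2, hB, map_pow]
  · rw [← h3, hC, map_pow]
  · rw [← hB]; field_simp

theorem IsSquarePresentation.eq₂ {x : K} {A D B C : ℚ[X]} (hP : IsSquarePresentation x A D B C) :
    x - 2 * RatFunc.X ^ 2 = (ι B / ι D) ^ 2 := by
  have hD0 : ι D ≠ 0 := (map_ne_zero_iff ι (RatFunc.algebraMap_injective ℚ)).2 hP.ne_zero
  rw [show x - 2 * RatFunc.X ^ 2 = (x - (RatFunc.X ^ 4 + 1)) + (RatFunc.X ^ 2 - 1) ^ 2 by ring,
    hP.eq, div_pow, div_pow, ← map_pow ι B, hP.sq₂]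
  simp only [map_mul, map_add, map_sub, map_pow, map_one, RatFunc.algebraMap_X]
  field_simp

theorem IsSquarePresentation.eq₃ {x : K} {A D B C : ℚ[X]} (hP : IsSquarePresentation x A D B C) :
    x + 2 * RatFunc.X ^ 2 = (ι C / ι D) ^ 2 := by
  have hD0 : ι D ≠ 0 := (map_ne_zero_iff ι (RatFunc.algebraMap_injective ℚ)).2 hP.ne_zero
  rw [show x + 2 * RatFunc.X ^ 2 = (x - (RatFunc.X ^ 4 + 1)) + (RatFunc.X ^ 2 + 1) ^ 2 by ring,
    hP.eq, div_pow, div_pow, ← map_pow ι C, hP.sq₃]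
  simp only [map_mul, map_add, map_pow, map_one, RatFunc.algebraMap_X]
  field_simp

variable [DecidableEq K]

theorem isSquare_third_of_double {x y x' y' : K}
    {h : (curveE (RatFunc.X : K)).toAffine.Nonsingular x y}
    {h' : (curveE (RatFunc.X : K)).toAffine.Nonsingular x' y'}
    (H : Affine.Point.some x y h + .some x y h = .some x' y' h') :
    IsSquare (x' + 2 * RatFunc.X ^ 2) := by
  have hy : y ≠ 0 := right_ne_zero_of_mul (double_X h h' H).1
  refine isSquare_of_isSquare_mul (IsSquare.one) one_ne_zero (factors_ne_zero h.1 hy).2.2 ?_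
  convert isSquare_of_add_eq h h h' H nonsingular_root'.1 using 1; ring

theorem exists_isSquarePresentation_of_double {x y x' y' : K}
    {h : (curveE (RatFunc.X : K)).toAffine.Nonsingular x y}
    {h' : (curveE (RatFunc.X : K)).toAffine.Nonsingular x' y'}
    (H : Affine.Point.some x y h + .some x y h = .some x' y' h') :
    ∃ A D B C, IsSquarePresentation x' A D B C := by
  obtain ⟨hy, h1, h2⟩ := double_X h h' H
  obtain ⟨A, D, B, C, hP, -⟩ := exists_isSquarePresentation
    (ξ := ((x - (RatFunc.X ^ 4 + 1)) ^ 2 - (RatFunc.X ^ 4 - 1) ^ 2) / (2 * y))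
    (η := ((x - 2 * RatFunc.X ^ 2) ^ 2 + 4 * RatFunc.X ^ 2 * (RatFunc.X ^ 2 - 1) ^ 2) / (2 * y))
    (by rw [div_pow, ← h1, mul_div_cancel_right₀ _ (pow_ne_zero 2 hy)])
    (by rw [div_pow, ← h2, mul_div_cancel_right₀ _ (pow_ne_zero 2 hy)])
    (isSquare_third_of_double H)
  exact ⟨A, D, B, C, hP⟩

/-- The duplication formula in terms of square presentations, with the fractions for the double point
cleared of denominators. -/
theorem exists_double_isSquarePresentation {x y x' y' : K}
    {h : (curveE (RatFunc.X : K)).toAffine.Nonsingular x y}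
    {h' : (curveE (RatFunc.X : K)).toAffine.Nonsingular x' y'}
    (H : Affine.Point.some x y h + .some x y h = .some x' y' h')
    {A D B C : ℚ[X]} (hP : IsSquarePresentation x A D B C) :
    ∃ A' D' B' C', IsSquarePresentation x' A' D' B' C' ∧
      A' * (2 * A * D * B * C) = D' * (A ^ 4 - (X ^ 2 - 1) ^ 2 * (X ^ 2 + 1) ^ 2 * D ^ 4) ∧
      B' * (2 * A * D * B * C) = D' * (B ^ 4 + 4 * X ^ 2 * (X ^ 2 - 1) ^ 2 * D ^ 4) := by
  obtain ⟨hy, h1, h2⟩ := double_X h h' H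
  have inj := RatFunc.algebraMap_injective ℚ
  have hD0 : ι D ≠ 0 := (map_ne_zero_iff ι inj).2 hP.ne_zero
  have hyy : (2 * y) ^ 2 = (2 * ι A * ι B * ι C / ι D ^ 3) ^ 2 := by
    rw [mul_pow, (curveE_equation_iff _ _ _).1 h.1, hP.eq₂, hP.eq₃, sub_sub, hP.eq]
    field_simp
  have hne : 2 * ι A * ι B * ι C ≠ 0 := by
    intro h0
    rw [h0] at hyy
    exact pow_ne_zero 2 hy (by rw [hyy]; simp)
  have hA : ι A ≠ 0 := by rintro h0; simp [h0] at hne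
  have hB : ι B ≠ 0 := by rintro h0; simp [h0] at hne
  have hC : ι C ≠ 0 := by rintro h0; simp [h0] at hne
  have h20 : (2 : K) ≠ 0 := by rintro h0; simp [h0] at hne
  rw [hyy, hP.eq] at h1
  rw [hyy, hP.eq₂] at h2
  obtain ⟨A', D', B', C', hP', e1, e2⟩ := exists_isSquarePresentation
    (ξ := (ι A ^ 4 - (RatFunc.X ^ 4 - 1) ^ 2 * ι D ^ 4) / (2 * ι A * ι D * ι B * ι C))
    (η := (ι B ^ 4 + 4 * RatFunc.X ^ 2 * (RatFunc.X ^ 2 - 1) ^ 2 * ι D ^ 4) /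
      (2 * ι A * ι D * ι B * ι C))
    (by
      field_simp at h1 ⊢
      linear_combination h1)
    (by
      field_simp at h2 ⊢
      linear_combination h2)
    (isSquare_third_of_double H)
  have hD0' : ι D' ≠ 0 := (map_ne_zero_iff ι inj).2 hP'.ne_zero
  refine ⟨A', D', B', C', hP', inj ?_, inj ?_⟩
  · simp only [map_mul, map_add, map_sub, map_pow, map_one, RatFunc.algebraMap_X, map_ofNat]
    field_simp at e1
    linear_combination -e1
  · simp only [map_mul, map_add, map_sub, map_pow, map_one, RatFunc.algebraMap_X, map_ofNat]
    field_simp at e2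
    linear_combination -e2

end Descent

/-! ### Absence of cancellation under doubling -/

section Descent

local notation "K" => RatFunc ℚ

theorem not_X_dvd_of_eval {f : ℚ[X]} (h : eval 0 f ≠ 0) : ¬(X : ℚ[X]) ∣ f := by
  rw [X_dvd_iff, coeff_zero_eq_eval_zero]; exact h

theorem not_X_sub_one_dvd {f : ℚ[X]} (h : eval 1 f ≠ 0) : ¬(X - 1 : ℚ[X]) ∣ f := by
  rw [show (X - 1 : ℚ[X]) = X - C 1 by simp, dvd_iff_isRoot]; exact h

theorem not_X_add_one_dvd {f : ℚ[X]} (h : eval (-1) f ≠ 0) : ¬(X + 1 : ℚ[X]) ∣ f := by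
  rw [show (X + 1 : ℚ[X]) = X - C (-1) by simp, dvd_iff_isRoot]; exact h

theorem not_X_sq_add_one_dvd_sq : ¬(X ^ 2 + 1 : ℚ[X]) ∣ (X ^ 2 - 1) ^ 2 := fun h ↦ by
  refine prime_X_sq_add_one.not_isUnit (IsCoprime.isUnit_of_dvd' ?_ dvd_rfl h)
  rw [show (X ^ 2 - 1 : ℚ[X]) = (X - 1) * (X + 1) by ring]
  exact (isCoprime_X_sq_add_one_X_sub_one.mul_right isCoprime_X_sq_add_one_X_add_one).pow_right

theorem IsSquarePresentation.coprime_BD {x : K} {A D B C : ℚ[X]}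
    (hP : IsSquarePresentation x A D B C) : IsCoprime B D := by
  have : IsCoprime (B ^ 2) D := by
    rw [hP.sq₂, show A ^ 2 + (X ^ 2 - 1) ^ 2 * D ^ 2 = A ^ 2 + D * ((X ^ 2 - 1) ^ 2 * D) by ring]
    exact (IsCoprime.add_mul_left_left_iff ..).2 hP.coprime.pow_left
  exact this.of_isCoprime_of_dvd_left (dvd_pow_self _ two_ne_zero)

/-- A point with square presentation `A, D, B, C` reduces to a smooth point at the places dividing
`r(r⁴ - 1)`: the node of the reduced cubic lies at `x = r⁴ + 1` where `r⁴ = 1`, and at `x = 2r²`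
where `r = 0`. -/
structure MeetsIdentityComponents (A B : ℚ[X]) : Prop where
  h₁ : ¬(X - 1) ∣ A
  h₂ : ¬(X + 1) ∣ A
  h₃ : ¬(X ^ 2 + 1) ∣ A
  h₄ : ¬X ∣ B

/-- All singular fibres at finite places are of type `I₄`, so the double of a double meets their
identity components. -/
theorem meetsIdentityComponents_of_double {x x' : K} {A D B C A' D' B' C' : ℚ[X]}
    (hP : IsSquarePresentation x A D B C) (hP' : IsSquarePresentation x' A' D' B' C')
    (hA : A' * (2 * A * D * B * C) = D' * (A ^ 4 - (X ^ 2 - 1) ^ 2 * (X ^ 2 + 1) ^ 2 * D ^ 4))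
    (hB : B' * (2 * A * D * B * C) = D' * (B ^ 4 + 4 * X ^ 2 * (X ^ 2 - 1) ^ 2 * D ^ 4)) :
    MeetsIdentityComponents A' B' := by
  -- A prime dividing `D` divides the denominator `D'` as well, hence neither `A'` nor `B'`.
  have key : ∀ p : ℚ[X], Prime p → p ∣ A' → ¬p ∣ D := by
    intro p hp h1 hD
    have h2 := (hp.dvd_or_dvd (hA ▸ h1.mul_right _)).resolve_left
      fun h ↦ hp.not_isUnit (hP'.coprime.isUnit_of_dvd' h1 h)
    rw [dvd_sub_left ((hD.pow four_ne_zero).mul_left _)] at h2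
    exact hp.not_isUnit (hP.coprime.isUnit_of_dvd' (hp.dvd_of_dvd_pow h2) hD)
  have key' : ∀ p : ℚ[X], Prime p → p ∣ B' → ¬p ∣ D := by
    intro p hp h1 hD
    have h2 := (hp.dvd_or_dvd (hB ▸ h1.mul_right _)).resolve_left
      fun h ↦ hp.not_isUnit (hP'.coprime_BD.isUnit_of_dvd' h1 h)
    rw [dvd_add_left ((hD.pow four_ne_zero).mul_left _)] at h2
    exact hp.not_isUnit (hP.coprime_BD.isUnit_of_dvd' (hp.dvd_of_dvd_pow h2) hD)
  refine ⟨fun h ↦ ?_, fun h ↦ ?_, fun h ↦ ?_, fun h ↦ ?_⟩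
  · refine prime_X_sub_one.not_dvd_of_double (c := A) (d := D) (e := B) (f := C)
      (g := (X + 1) ^ 2) (h := (X + 1) ^ 2 * (X ^ 2 + 1) ^ 2) hP'.coprime
      (key _ prime_X_sub_one h) (not_X_sub_one_dvd (by norm_num)) ?_ ?_ h
    · rw [hP.sq₂]; ring
    · rw [hA]; ring
  · refine prime_X_add_one.not_dvd_of_double (c := A) (d := D) (e := B) (f := C)
      (g := (X - 1) ^ 2) (h := (X - 1) ^ 2 * (X ^ 2 + 1) ^ 2) hP'.coprime
      (key _ prime_X_add_one h) (not_X_add_one_dvd (by norm_num)) ?_ ?_ h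
    · rw [hP.sq₂]; ring
    · rw [hA]; ring
  · refine prime_X_sq_add_one.not_dvd_of_double (c := A) (d := D) (e := C) (f := B)
      (g := 1) (h := (X ^ 2 - 1) ^ 2) hP'.coprime
      (key _ prime_X_sq_add_one h) not_X_sq_add_one_dvd_sq ?_ ?_ h
    · rw [hP.sq₃]; ring
    · linear_combination hA
  · refine prime_X.not_dvd_of_double (c := B) (d := D) (e := C) (f := A)
      (g := 4) (h := -4 * (X ^ 2 - 1) ^ 2) hP'.coprime_BD
      (key' _ prime_X h) (not_X_dvd_of_eval (by norm_num)) ?_ ?_ h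
    · rw [hP.sq₃, hP.sq₂]; ring
    · linear_combination hB

theorem IsSquarePresentation.natDegree_lt {x : K} {A D B C : ℚ[X]}
    (hP : IsSquarePresentation x A D B C) : D.natDegree < C.natDegree := by
  set E := (X ^ 2 + 1) * D with hE
  have hX0 : (X ^ 2 + 1 : ℚ[X]) ≠ 0 := prime_X_sq_add_one.ne_zero
  have hEd : E.natDegree = 2 + D.natDegree := by
    rw [hE, natDegree_mul hX0 hP.ne_zero, natDegree_X_sq_add_one]
  have hE0 : E ≠ 0 := mul_ne_zero hX0 hP.ne_zero
  have hC : C ^ 2 = A ^ 2 + E ^ 2 := by rw [hP.sq₃, hE]; ring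
  -- leading terms cannot cancel in a sum of two squares over `ℚ`
  have hle : (E ^ 2).natDegree ≤ (C ^ 2).natDegree := by
    rw [hC]
    rcases lt_trichotomy A.natDegree E.natDegree with h | h | h
    · rw [natDegree_add_eq_right_of_natDegree_lt (by rw [natDegree_pow, natDegree_pow]; omega)]
    · have hAE : (E ^ 2).natDegree = (A ^ 2).natDegree := by
        rw [natDegree_pow, natDegree_pow, h]
      apply le_natDegree_of_ne_zero
      rw [coeff_add]
      nth_rw 1 [hAE]
      rw [coeff_natDegree, coeff_natDegree, leadingCoeff_pow, leadingCoeff_pow]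
      have := leadingCoeff_ne_zero.2 hE0
      positivity
    · rw [natDegree_add_eq_left_of_natDegree_lt (by rw [natDegree_pow, natDegree_pow]; omega),
        natDegree_pow, natDegree_pow]
      omega
  rw [natDegree_pow, natDegree_pow] at hle
  omega

/-- For a point that meets the identity components there is no cancellation in the duplication
formula. -/
theorem isCoprime_double {x : K} {A D B C : ℚ[X]}
    (hP : IsSquarePresentation x A D B C) (h : MeetsIdentityComponents A B) :
    IsCoprime (A * D * B * C) (A ^ 4 - (X ^ 2 - 1) ^ 2 * (X ^ 2 + 1) ^ 2 * D ^ 4) := by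
  have hA0 : A ≠ 0 := by rintro rfl; exact h.h₁ (dvd_zero _)
  have hassoc : ∀ {p q f : ℚ[X]}, Prime p → Prime q → p ∣ q → p ∣ f → q ∣ f :=
    fun hp hq h1 h2 ↦ (hp.associated_of_dvd hq h1).symm.dvd.trans h2
  have ha : ∀ p : ℚ[X], Prime p → p ∣ A → ¬p ∣ X ^ 2 - 1 := fun p hp h1 h2 ↦ by
    rw [show (X ^ 2 - 1 : ℚ[X]) = (X - 1) * (X + 1) by ring] at h2
    exact (hp.dvd_or_dvd h2).elim (fun h2 ↦ h.h₁ (hassoc hp prime_X_sub_one h2 h1))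
      fun h2 ↦ h.h₂ (hassoc hp prime_X_add_one h2 h1)
  have hb : ∀ p : ℚ[X], Prime p → p ∣ A → ¬p ∣ X ^ 2 + 1 := fun p hp h1 h2 ↦
    h.h₃ (hassoc hp prime_X_sq_add_one h2 h1)
  have hd : ∀ p : ℚ[X], Prime p → p ∣ A → ¬p ∣ D := fun p hp h1 h2 ↦
    hp.not_isUnit (hP.coprime.isUnit_of_dvd' h1 h2)
  have h4 : ∀ p : ℚ[X], Prime p → ¬p ∣ 4 := fun p hp h4 ↦
    hp.not_isUnit (isUnit_of_dvd_unit h4 (by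
      rw [show (4 : ℚ[X]) = Polynomial.C 4 from rfl]; exact isUnit_C.2 (by norm_num)))
  refine isCoprime_of_prime_dvd (fun h0 ↦ ?_) fun p hp h1 h2 ↦ ?_
  · rcases mul_eq_zero.1 h0.1 with h0 | h0
    · rcases mul_eq_zero.1 h0 with h0 | h0
      · exact (mul_ne_zero hA0 hP.ne_zero) h0
      · exact h.h₄ (h0 ▸ dvd_zero _)
    · have := hP.natDegree_lt
      simp [h0] at this
  have hX : p ∣ X → ¬p ∣ B := fun h1 h2 ↦ h.h₄ (hassoc hp prime_X h1 h2)
  by_cases hpA : p ∣ A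
  · rw [dvd_sub_right (dvd_pow hpA four_ne_zero)] at h2
    rcases hp.dvd_or_dvd h2 with h2 | h2
    · exact (hp.dvd_or_dvd h2).elim (fun h ↦ ha p hp hpA (hp.dvd_of_dvd_pow h))
        fun h ↦ hb p hp hpA (hp.dvd_of_dvd_pow h)
    · exact hd p hp hpA (hp.dvd_of_dvd_pow h2)
  by_cases hpD : p ∣ D
  · rw [dvd_sub_left ((hpD.pow four_ne_zero).mul_left _)] at h2
    exact hpA (hp.dvd_of_dvd_pow h2)
  by_cases hpB : p ∣ B
  · have h3 : p ∣ 4 * X ^ 2 * (X ^ 2 - 1) ^ 2 * D ^ 4 := by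
      have := dvd_sub ((dvd_pow hpB two_ne_zero).mul_right (A ^ 2 - (X ^ 2 - 1) ^ 2 * D ^ 2)) h2
      rw [hP.sq₂] at this
      convert this using 1; ring
    rcases hp.dvd_or_dvd h3 with h3 | h3
    · rcases hp.dvd_or_dvd h3 with h3 | h3
      · exact (hp.dvd_or_dvd h3).elim (h4 p hp) fun h ↦ hX (hp.dvd_of_dvd_pow h) hpB
      · have h5 := dvd_pow hpB two_ne_zero
        rw [hP.sq₂, dvd_add_left (h3.mul_right _)] at h5
        exact hpA (hp.dvd_of_dvd_pow h5)
    · exact hpD (hp.dvd_of_dvd_pow h3)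
  have hpC : p ∣ C := ((hp.dvd_or_dvd h1).resolve_left fun h ↦ (hp.dvd_or_dvd h).elim
    (fun h ↦ (hp.dvd_or_dvd h).elim hpA hpD) hpB)
  have h3 : p ∣ 4 * X ^ 2 * (X ^ 2 + 1) ^ 2 * D ^ 4 := by
    have := dvd_sub h2 ((dvd_pow hpC two_ne_zero).mul_right (A ^ 2 - (X ^ 2 + 1) ^ 2 * D ^ 2))
    rw [hP.sq₃] at this
    convert this using 1; ring
  rcases hp.dvd_or_dvd h3 with h3 | h3
  · rcases hp.dvd_or_dvd h3 with h3 | h3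
    · refine (hp.dvd_or_dvd h3).elim (h4 p hp) fun h ↦ hpB (hp.dvd_of_dvd_pow (n := 2) ?_)
      rw [show B ^ 2 = C ^ 2 - 4 * X ^ 2 * D ^ 2 by rw [hP.sq₂, hP.sq₃]; ring]
      exact dvd_sub (dvd_pow hpC two_ne_zero) ((h.mul_left _).mul_right _)
    · have h5 := dvd_pow hpC two_ne_zero
      rw [hP.sq₃, dvd_add_left (h3.mul_right _)] at h5
      exact hpA (hp.dvd_of_dvd_pow h5)
  · exact hpD (hp.dvd_of_dvd_pow h3)

end Descent

/-! ### Infinite descent -/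

section Descent

local notation "K" => RatFunc ℚ
local notation "ι" => algebraMap ℚ[X] (RatFunc ℚ)

theorem IsSquarePresentation.dvd {x : K} {A D B C A' D' B' C' : ℚ[X]}
    (hP : IsSquarePresentation x A D B C) (hP' : IsSquarePresentation x A' D' B' C') :
    D ∣ D' := by
  have inj := RatFunc.algebraMap_injective ℚ
  have hD0 : ι D ≠ 0 := (map_ne_zero_iff ι inj).2 hP.ne_zero
  have hD0' : ι D' ≠ 0 := (map_ne_zero_iff ι inj).2 hP'.ne_zero
  have h : A ^ 2 * D' ^ 2 = A' ^ 2 * D ^ 2 := by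
    apply inj
    have := hP.eq.symm.trans hP'.eq
    simp only [map_mul, map_pow]
    field_simp at this
    linear_combination this
  rw [← IsIntegrallyClosed.pow_dvd_pow_iff (n := 2) two_ne_zero]
  refine (hP.coprime.symm.pow (m := 2) (n := 2)).dvd_of_dvd_mul_left ?_
  rw [h]
  exact dvd_mul_left _ _

/-- Doubling a point that meets the identity components strictly increases the degree of the
denominator. -/
theorem IsSquarePresentation.natDegree_lt_of_double {x x' : K} {A D B C A' D' B' C' : ℚ[X]}
    (hP : IsSquarePresentation x A D B C) (hP' : IsSquarePresentation x' A' D' B' C')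
    (hA : A' * (2 * A * D * B * C) = D' * (A ^ 4 - (X ^ 2 - 1) ^ 2 * (X ^ 2 + 1) ^ 2 * D ^ 4))
    (h : MeetsIdentityComponents A B) : D.natDegree < D'.natDegree := by
  have h1 : C ∣ D' :=
    (dvd_mul_left _ _).trans ((isCoprime_double hP h).dvd_of_dvd_mul_right
      (hA ▸ (⟨A' * 2, by ring⟩ : A * D * B * C ∣ _)))
  exact hP.natDegree_lt.trans_le (natDegree_le_of_dvd h1 hP'.ne_zero)

variable [DecidableEq K]

theorem four_nsmul_of_mem {t : (curveE (RatFunc.X : K)).toAffine.Point} (ht : t ∈ torsionGroup) :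
    4 • t = 0 := by
  induction ht using AddSubgroup.closure_induction with
  | mem t ht =>
    rcases ht with rfl | rfl
    · rw [show (4 : ℕ) = 2 * 2 from rfl, mul_nsmul, two_nsmul pointFour, pointFour_add_self,
        two_nsmul, add_self_eq_zero_of_Y_eq_zero]
    · rw [show (4 : ℕ) = 2 * 2 from rfl, mul_nsmul, two_nsmul pointTwo, pointTwo_add_self,
        nsmul_zero]
  | zero => exact nsmul_zero 4
  | add s t _ _ hs ht => rw [nsmul_add, hs, ht, add_zero]
  | neg t _ ht => rw [neg_nsmul, ht, neg_zero]

omit [DecidableEq K] in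
theorem eq_zero_or_exists_eq_some (P : (curveE (RatFunc.X : K)).toAffine.Point) :
    P = 0 ∨ ∃ x y h, P = .some x y h := by
  cases P with
  | zero => exact Or.inl rfl
  | some x y h => exact Or.inr ⟨x, y, h, rfl⟩

/-- Infinite descent on the degree of the denominator. If `4P` is not zero, write `P = t + 2P'` with
`4t = 0`; then `4P = 2(4P')`, and `4P'` has a denominator of smaller degree. -/
theorem four_nsmul_ne_some (P : (curveE (RatFunc.X : K)).toAffine.Point) {x y : K}
    (h : (curveE (RatFunc.X : K)).toAffine.Nonsingular x y) {A D B C : ℚ[X]}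
    (hP : IsSquarePresentation x A D B C) : 4 • P ≠ .some x y h := by
  induction hn : D.natDegree using Nat.strong_induction_on generalizing P x y A D B C with
  | _ n ih =>
  intro hx
  obtain ⟨t, ht, P', rfl⟩ := exists_eq_torsion_add_add_self P
  have h8 : 4 • P' + 4 • P' = .some x y h := by
    rw [← hx, nsmul_add, four_nsmul_of_mem ht, nsmul_add, zero_add]
  have h4 : 2 • P' + 2 • P' = 4 • P' := by rw [← add_nsmul]
  rcases eq_zero_or_exists_eq_some (4 • P') with hS | ⟨x₁, y₁, h₁, hS⟩
  · rw [hS, add_zero] at h8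
    exact Affine.Point.some_ne_zero h h8.symm
  rcases eq_zero_or_exists_eq_some (2 • P') with hQ | ⟨x₂, y₂, h₂, hQ⟩
  · rw [← h4, hQ, add_zero] at hS
    exact Affine.Point.some_ne_zero h₁ hS.symm
  rcases eq_zero_or_exists_eq_some P' with h0 | ⟨x₃, y₃, h₃, rfl⟩
  · rw [h0, nsmul_zero] at hQ
    exact Affine.Point.some_ne_zero h₂ hQ.symm
  rw [hS] at h8
  rw [hS, hQ] at h4
  rw [two_nsmul] at hQ
  obtain ⟨A₂, D₂, B₂, C₂, hP₂⟩ := exists_isSquarePresentation_of_double hQ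
  obtain ⟨A₁, D₁, B₁, C₁, hP₁, hA₁, hB₁⟩ := exists_double_isSquarePresentation h4 hP₂
  obtain ⟨A₀, D₀, B₀, C₀, hP₀, hA₀, -⟩ := exists_double_isSquarePresentation h8 hP₁
  have hlt := hP₁.natDegree_lt_of_double hP₀ hA₀
    (meetsIdentityComponents_of_double hP₂ hP₁ hA₁ hB₁)
  exact ih _ (hn ▸ hlt.trans_le (natDegree_le_of_dvd (hP₀.dvd hP) hP.ne_zero)) _ h₁ hP₁ rfl hS

theorem four_nsmul_eq_zero (P : (curveE (RatFunc.X : K)).toAffine.Point) : 4 • P = 0 := by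
  rcases eq_zero_or_exists_eq_some (4 • P) with h | ⟨x, y, h, hx⟩
  · exact h
  rcases eq_zero_or_exists_eq_some (2 • P) with h2 | ⟨x₂, y₂, h₂, h2⟩
  · rw [show (4 : ℕ) = 2 * 2 from rfl, mul_nsmul, h2, nsmul_zero]
  have h4 : 2 • P + 2 • P = 4 • P := by rw [← add_nsmul]
  rw [h2, hx] at h4
  obtain ⟨A, D, B, C, hP⟩ := exists_isSquarePresentation_of_double h4
  exact absurd hx (four_nsmul_ne_some P h hP)

theorem torsionGroup_eq_top : torsionGroup = ⊤ := by
  rw [eq_top_iff]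
  intro P _
  obtain ⟨t, ht, Q, rfl⟩ := exists_eq_torsion_add_add_self P
  obtain ⟨s, hs, R, rfl⟩ := exists_eq_torsion_add_add_self Q
  have : t + (s + (R + R) + (s + (R + R))) = t + (s + s) + 4 • R := by
    rw [show (4 : ℕ) • R = R + R + (R + R) by abel]; abel
  rw [this, four_nsmul_eq_zero, add_zero]
  exact add_mem ht (add_mem hs hs)

end Descent

/-! ### The torsion subgroup -/

section Torsion

local notation "K" => RatFunc ℚ

theorem nonsingular_two_four :
    (curveE (RatFunc.X : K)).toAffine.Nonsingular 2 (2 * (RatFunc.X ^ 4 - 1)) := by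
  rw [← Affine.equation_iff_nonsingular, curveE_equation_iff]; ring

theorem neg_nonsingular {x y : K} (h : (curveE (RatFunc.X : K)).toAffine.Nonsingular x y) :
    (curveE (RatFunc.X : K)).toAffine.Nonsingular x (-y) := by
  rwa [← curveE_negY (r := (RatFunc.X : K)) x, Affine.nonsingular_neg]

theorem neg_some_eq {x y : K} (h : (curveE (RatFunc.X : K)).toAffine.Nonsingular x y) :
    -Affine.Point.some x y h = .some x (-y) (neg_nonsingular h) := by
  rw [Affine.Point.neg_some, Affine.Point.some.injEq]
  exact ⟨rfl, curveE_negY x y⟩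

variable [DecidableEq K]

theorem pointTwo_add_pointFour : pointTwo + pointFour = .some _ _ nonsingular_two_four := by
  have h0 : (2 * RatFunc.X ^ 2 - 2 * RatFunc.X ^ 4 : K) ≠ 0 := by
    have := ratFunc_ne_zero_of_eval (f := 2 * X ^ 2 - 2 * X ^ 4) 2 (by norm_num)
    simpa [RatFunc.algebraMap_X, map_ofNat] using this
  have hsl : (curveE (RatFunc.X : K)).toAffine.slope (2 * RatFunc.X ^ 2) (2 * RatFunc.X ^ 4) 0
      (2 * RatFunc.X ^ 2 * (RatFunc.X ^ 4 - 1)) = RatFunc.X ^ 2 + 1 := by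
    rw [Affine.slope_of_X_ne (sub_ne_zero.1 h0), div_eq_iff h0]
    ring
  rw [pointTwo, pointFour, Affine.Point.add_of_X_ne (sub_ne_zero.1 h0), Affine.Point.some.injEq,
    hsl]
  constructor
  · simp only [Affine.addX, curveE]; ring
  · simp only [Affine.addY, Affine.negY, Affine.negAddY, Affine.addX, curveE]; ring

theorem pointFour_four : (4 : ℤ) • pointFour = 0 := by
  exact_mod_cast four_nsmul_eq_zero pointFour

theorem pointTwo_two : (2 : ℤ) • pointTwo = 0 := by
  rw [two_zsmul, pointTwo_add_self]

/-- The homomorphism sending `(1, 0)` to `pointTwo` and `(0, 1)` to `pointFour`. -/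
noncomputable def torsionHom : ZMod 2 × ZMod 4 →+ (curveE (RatFunc.X : K)).toAffine.Point :=
  (ZMod.lift 2 ⟨zmultiplesHom _ pointTwo, by simpa using pointTwo_two⟩).coprod
    (ZMod.lift 4 ⟨zmultiplesHom _ pointFour, by simpa using pointFour_four⟩)

theorem torsionHom_apply (m n : ℤ) :
    torsionHom ((m : ZMod 2), (n : ZMod 4)) = m • pointTwo + n • pointFour := by
  simp [torsionHom]

theorem torsionHom_surjective : Function.Surjective torsionHom := by
  rw [← AddMonoidHom.range_eq_top, eq_top_iff, ← torsionGroup_eq_top, torsionGroup,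
    AddSubgroup.closure_le]
  rintro P (rfl | rfl)
  · exact ⟨(((0 : ℤ) : ZMod 2), ((1 : ℤ) : ZMod 4)), by rw [torsionHom_apply]; simp⟩
  · exact ⟨(((1 : ℤ) : ZMod 2), ((0 : ℤ) : ZMod 4)), by rw [torsionHom_apply]; simp⟩

theorem torsionHom_values :
    torsionHom (0, 0) = 0 ∧
    torsionHom (0, 1) = .some _ _ nonsingular_four ∧
    torsionHom (0, 2) = .some _ _ nonsingular_root ∧
    torsionHom (0, 3) = .some _ _ (neg_nonsingular nonsingular_four) ∧
    torsionHom (1, 0) = .some _ _ nonsingular_two ∧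
    torsionHom (1, 1) = .some _ _ nonsingular_two_four ∧
    torsionHom (1, 2) = .some _ _ nonsingular_root' ∧
    torsionHom (1, 3) = .some _ _ (neg_nonsingular nonsingular_two_four) := by
  have h2 : -pointTwo = pointTwo := neg_eq_of_add_eq_zero_left pointTwo_add_self
  have h3 : (3 : ℤ) • pointFour = -pointFour := by
    rw [eq_neg_iff_add_eq_zero, ← pointFour_four]; abel
  refine ⟨map_zero _, ?_, ?_, ?_, ?_, ?_, ?_, ?_⟩
  · have := torsionHom_apply 0 1
    rw [zero_zsmul, one_zsmul, zero_add, pointFour] at this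
    simpa using this
  · have := torsionHom_apply 0 2
    rw [two_zsmul, pointFour_add_self] at this
    simpa using this
  · have := torsionHom_apply 0 3
    rw [h3, pointFour, neg_some_eq] at this
    simpa using this
  · have := torsionHom_apply 1 0
    rw [zero_zsmul, one_zsmul, add_zero, pointTwo] at this
    simpa using this
  · have := torsionHom_apply 1 1
    rw [one_zsmul, one_zsmul, pointTwo_add_pointFour] at this
    simpa using this
  · have := torsionHom_apply 1 2
    rw [one_zsmul, two_zsmul, pointFour_add_self, add_comm, root_add_pointTwo] at this
    simpa using this
  · have := torsionHom_apply 1 3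
    rw [h3, one_zsmul, ← h2, ← neg_add, pointTwo_add_pointFour, neg_some_eq] at this
    simpa using this

theorem torsionHom_injective : Function.Injective torsionHom := by
  obtain ⟨-, h1, h2, h3, h4, h5, h6, h7⟩ := torsionHom_values
  rw [injective_iff_map_eq_zero]
  rintro ⟨m, n⟩ h
  fin_cases m <;> fin_cases n
  · rfl
  · exact absurd (h1.symm.trans h) (Affine.Point.some_ne_zero _)
  · exact absurd (h2.symm.trans h) (Affine.Point.some_ne_zero _)
  · exact absurd (h3.symm.trans h) (Affine.Point.some_ne_zero _)
  · exact absurd (h4.symm.trans h) (Affine.Point.some_ne_zero _)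
  · exact absurd (h5.symm.trans h) (Affine.Point.some_ne_zero _)
  · exact absurd (h6.symm.trans h) (Affine.Point.some_ne_zero _)
  · exact absurd (h7.symm.trans h) (Affine.Point.some_ne_zero _)

theorem torsion_eq_top : AddCommGroup.torsion (curveE (RatFunc.X : K)).toAffine.Point = ⊤ := by
  rw [eq_top_iff]
  intro P _
  exact isOfFinAddOrder_iff_nsmul_eq_zero.2 ⟨4, by norm_num, four_nsmul_eq_zero P⟩

theorem eq_torsionHom_values (P : (curveE (RatFunc.X : K)).toAffine.Point) :
    P = 0 ∨ P = .some _ _ nonsingular_root' ∨ P = .some _ _ nonsingular_two ∨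
      P = .some _ _ nonsingular_root ∨ P = .some _ _ nonsingular_four ∨
      P = .some _ _ (neg_nonsingular nonsingular_four) ∨ P = .some _ _ nonsingular_two_four ∨
      P = .some _ _ (neg_nonsingular nonsingular_two_four) := by
  obtain ⟨h0, h1, h2, h3, h4, h5, h6, h7⟩ := torsionHom_values
  obtain ⟨⟨m, n⟩, rfl⟩ := torsionHom_surjective P
  fin_cases m <;> fin_cases n
  · exact .inl h0
  · exact .inr (.inr (.inr (.inr (.inl h1))))
  · exact .inr (.inr (.inr (.inl h2)))
  · exact .inr (.inr (.inr (.inr (.inr (.inl h3)))))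
  · exact .inr (.inr (.inl h4))
  · exact .inr (.inr (.inr (.inr (.inr (.inr (.inl h5))))))
  · exact .inr (.inl h6)
  · exact .inr (.inr (.inr (.inr (.inr (.inr (.inr h7))))))

end Torsion

theorem mainTheorem3 [DecidableEq (RatFunc ℚ)] :
    genericE.IsElliptic ∧
    Module.rank ℤ genericE.toAffine.Point = 0 ∧
    Nonempty (AddCommGroup.torsion genericE.toAffine.Point ≃+ ZMod 2 × ZMod 4) ∧
    ∃ (h₁ : genericE.toAffine.Nonsingular (-2 * RatFunc.X ^ 2) 0)
      (h₂ : genericE.toAffine.Nonsingular (2 * RatFunc.X ^ 2) 0)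
      (h₃ : genericE.toAffine.Nonsingular (RatFunc.X ^ 4 + 1) 0)
      (h₄ : genericE.toAffine.Nonsingular (2 * RatFunc.X ^ 4)
        (2 * RatFunc.X ^ 2 * (RatFunc.X ^ 4 - 1)))
      (h₅ : genericE.toAffine.Nonsingular (2 * RatFunc.X ^ 4)
        (-(2 * RatFunc.X ^ 2 * (RatFunc.X ^ 4 - 1))))
      (h₆ : genericE.toAffine.Nonsingular 2 (2 * (RatFunc.X ^ 4 - 1)))
      (h₇ : genericE.toAffine.Nonsingular 2 (-(2 * (RatFunc.X ^ 4 - 1)))),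
      (AddCommGroup.torsion genericE.toAffine.Point : Set genericE.toAffine.Point) =
        {0, .some _ _ h₁, .some _ _ h₂, .some _ _ h₃, .some _ _ h₄, .some _ _ h₅,
          .some _ _ h₆, .some _ _ h₇} := by
  refine ⟨isElliptic_curveE_X, rank_eq_zero_iff.2 fun P ↦ ⟨4, by norm_num, ?_⟩, ?_,
    nonsingular_root', nonsingular_two, nonsingular_root, nonsingular_four,
    neg_nonsingular nonsingular_four, nonsingular_two_four, neg_nonsingular nonsingular_two_four,
    ?_⟩
  · exact_mod_cast four_nsmul_eq_zero P
  · exact ⟨((AddEquiv.ofBijective torsionHom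
      ⟨torsionHom_injective, torsionHom_surjective⟩).trans (AddSubgroup.topEquiv.symm.trans
        (AddEquiv.addSubgroupCongr torsion_eq_top.symm))).symm⟩
  · exact Set.ext fun P ↦ ⟨fun _ ↦ eq_torsionHom_values P,
      fun _ ↦ torsion_eq_top.ge (AddSubgroup.mem_top P)⟩
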